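/- Let $\sigma(v)_i=e^{v_i}/\sum_j e^{v_j}$ be the softmax map on $\mathbb R^n$. Let $A_h\in\mathbb R^{m\times m}$, $B_h\in\mathbb R^{m\times 1}$, $C_h\in\mathbb R^{1\times m}$, where $A_h$ is asymptotically stable (all eigenvalues have negative real part), and let the transfer function $h(s)=C_h(sI_m-A_h)^{-1}B_h$ be passive, i.e. $\operatorname{Re}h(j\omega)\ge 0$ for all $\omega\in\mathbb R$. Standard replicator dynamics (RD) is $\dot z_{\mathrm R}=p$, $x_{\mathrm R}=\sigma(z_{\mathrm R})$. Predictive RD is $$\dot r=p,\quad \dot x_h=(A_h\otimes I_n)x_h+(B_h\otimes I_n)p,\quad m=(C_h\otimes I_n)x_h,\quad x_{\mathrm{PR}}=\sigma(r+m).$$ With $r=z_{\mathrm R}$, the comparison system is the system with state $(z_{\mathrm R},x_h)$, input $p$ and output $y=x_{\mathrm{PR}}-x_{\mathrm R}=\sigma(z_{\mathrm R}+m)-\sigma(z_{\mathrm R})$. The uniform trajectory is $p^*(t)=\mathbf 1_n$, $z_{\mathrm R}^*(t)=t\,\mathbf 1_n$, $x_h^*=((-A_h)^{-1}B_h)\otimes\mathbf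 1_n$; it is a trajectory of the comparison system, and its output is $y^*=0$. Write $\Delta$ for deviations from it in the linearized systems. Inputs $\Delta p$ range over all signals on $[0,\infty)$ that are square integrable on every finite interval. Then predictive RD locally uniformly dominates standard RD, in the following sense. 1. The comparison system linearized about the uniform trajectory is passive from $\Delta p$ to $\Delta y$. As an input-output operator started at zero deviation, it satisfies $\int_0^T\Delta p^\top\Delta y\,dt\ge\alpha$ for some constant $\alpha$, all $\Delta p$ and all $T\ge 0$. If moreover $(A_h,B_h)$ is controllable, or the realization $\dot x=A_hx+B_hu$, $y=C_hx$ is itself passive in the state-space sense, then the linearized comparison system is passive in the state-space sense. Here a system with state $x$, input $u$ and output $y$ is passive in the state-space sense if there is a $C^1$ function $V\ge 0$ of the state with $V(x(T))-V(x(0))\le\int_0^T u^\top y\,dt$ for all inputs, all initial states and all $T\ge 0$. 2. Let $p=p^*+\Delta p$, and let $x_{\mathrm{PR}}=x_{\mathrm{PR}}^*+\Delta x_{\mathrm{PR}}$ and $x_{\mathrm R}=x_{\mathrm R}^*+\Delta x_{\mathrm R}$ be the strategies given by the linearizations of predictive and standard RD about the uniform trajectory, started at zero deviation. Then $$\int_0^T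 p^\top x_{\mathrm{PR}}\,dt\ \ge\ \int_0^T p^\top x_{\mathrm R}\,dt\qquad\text{for all }T>0.$$ 3. If $h$ is strictly passive, i.e. $\operatorname{Re}h(j\omega)>0$ for all $\omega\in\mathbb R$, then the inequality in 2 is strict for every $T>0$ such that $\Delta p(t)\in\operatorname{span}\{\mathbf 1_n\}$ does not hold for almost every $t\in[0,T]$. -/

import Mathlib

open MeasureTheory
open scoped Matrix Kronecker

noncomputable section

/-- A (possibly time-varying) system `x' = dyn t x u`, `y = out t x u`. -/
structure ControlSystem (X U Y : Type*) where
  dyn : ℝ → X → U → X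
  out : ℝ → X → U → Y

namespace ControlSystem

variable {X U Y : Type*}

/-- `x` is the state trajectory on `[0, ∞)` driven by the input `u`
(Carathéodory solution, since inputs are only locally square integrable). -/
def IsTrajectory [NormedAddCommGroup X] [NormedSpace ℝ X]
    (G : ControlSystem X U Y) (u : ℝ → U) (x : ℝ → X) : Prop :=
  ContinuousOn x (Set.Ici 0) ∧
    ∀ t : ℝ, 0 ≤ t →
      IntervalIntegrable (fun τ => G.dyn τ (x τ) (u τ)) volume 0 t ∧
      x t = x 0 + ∫ τ in (0 : ℝ)..t, G.dyn τ (x τ) (u τ)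

/-- The linearization of a system about the nominal state trajectory `xs` and input `us`:
the system satisfied to first order by the deviations `(x - xs, u - us, y - ys)`. -/
def linearize [NormedAddCommGroup X] [NormedSpace ℝ X] [NormedAddCommGroup U]
    [NormedSpace ℝ U] [NormedAddCommGroup Y] [NormedSpace ℝ Y]
    (G : ControlSystem X U Y) (xs : ℝ → X) (us : ℝ → U) : ControlSystem X U Y where
  dyn t ξ ν := fderiv ℝ (fun q : X × U => G.dyn t q.1 q.2) (xs t, us t) (ξ, ν)
  out t ξ ν := fderiv ℝ (fun q : X × U => G.out t q.1 q.2) (xs t, us t) (ξ, ν)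

/-- The first-order output `ys + Δy`, where `Δy` is the output of the linearization about
`(xs, us)` at the deviations `(ξ, ν)` of state and input. -/
def firstOrderOutput [NormedAddCommGroup X] [NormedSpace ℝ X] [NormedAddCommGroup U]
    [NormedSpace ℝ U] [NormedAddCommGroup Y] [NormedSpace ℝ Y]
    (G : ControlSystem X U Y) (xs : ℝ → X) (us : ℝ → U) (ξ : ℝ → X) (ν : ℝ → U) : ℝ → Y :=
  fun t => G.out t (xs t) (us t) + (G.linearize xs us).out t (ξ t) (ν t)

end ControlSystem

/-- Vector signals on `[0, ∞)` that are square integrable on every finite interval. -/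
def IsLocallySquareIntegrable {k : ℕ} (u : ℝ → Fin k → ℝ) : Prop :=
  ∀ T : ℝ, 0 < T → MemLp u 2 (volume.restrict (Set.Icc 0 T))

namespace ControlSystem

variable {X : Type*} [NormedAddCommGroup X] [NormedSpace ℝ X] {k : ℕ}

/-- State-space passivity: there is a continuously differentiable storage function `V ≥ 0` with
`V (x T) - V (x 0) ≤ ∫₀ᵀ uᵀ y` for all inputs, all initial states and all horizons. -/
def IsPassive (G : ControlSystem X (Fin k → ℝ) (Fin k → ℝ)) : Prop :=
  ∃ V : X → ℝ, ContDiff ℝ 1 V ∧ (∀ x, 0 ≤ V x) ∧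
    ∀ (u : ℝ → Fin k → ℝ) (x : ℝ → X), IsLocallySquareIntegrable u → G.IsTrajectory u x →
      ∀ T : ℝ, 0 ≤ T → V (x T) - V (x 0) ≤ ∫ t in (0 : ℝ)..T, u t ⬝ᵥ G.out t (x t) (u t)

/-- Passivity of the input-output operator `u ↦ y` of the system started at the zero state:
`⟨y, u⟩_T` is bounded below uniformly in the input and the horizon. -/
def IsIOPassive (G : ControlSystem X (Fin k → ℝ) (Fin k → ℝ)) : Prop :=
  ∃ α : ℝ, ∀ (u : ℝ → Fin k → ℝ) (x : ℝ → X), IsLocallySquareIntegrable u →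
    G.IsTrajectory u x → x 0 = 0 →
      ∀ T : ℝ, 0 ≤ T → α ≤ ∫ t in (0 : ℝ)..T, u t ⬝ᵥ G.out t (x t) (u t)

end ControlSystem

/-- The softmax map `σ`. -/
def softmax {n : ℕ} (v : Fin n → ℝ) : Fin n → ℝ :=
  fun i => Real.exp (v i) / ∑ j, Real.exp (v j)

/-- L1 (strategy `x₁`) uniformly dominates L2 (strategy `x₂`) for the payoff signal `p`. -/
def UniformlyDominates {n : ℕ} (p x₁ x₂ : ℝ → Fin n → ℝ) : Prop :=
  ∀ T : ℝ, 0 < T →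
    ∫ t in (0 : ℝ)..T, p t ⬝ᵥ x₂ t ≤ ∫ t in (0 : ℝ)..T, p t ⬝ᵥ x₁ t

/-- Standard replicator dynamics `z' = p`, `x = σ(z)`. -/
def standardRD (n : ℕ) : ControlSystem (Fin n → ℝ) (Fin n → ℝ) (Fin n → ℝ) where
  dyn _ _ p := p
  out _ z _ := softmax z

section Predictor

variable {m : ℕ} (A : Matrix (Fin m) (Fin m) ℝ) (B : Matrix (Fin m) (Fin 1) ℝ)
  (C : Matrix (Fin 1) (Fin m) ℝ)

/-- All eigenvalues of `A` have negative real part. -/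
def IsHurwitz : Prop :=
  ∀ μ ∈ spectrum ℂ (A.map (Complex.ofReal : ℝ → ℂ)), μ.re < 0

/-- The scalar transfer function `h(s) = C (sI - A)⁻¹ B`. -/
def transferFunction (s : ℂ) : ℂ :=
  (C.map (Complex.ofReal : ℝ → ℂ) * (s • (1 : Matrix (Fin m) (Fin m) ℂ) -
    A.map (Complex.ofReal : ℝ → ℂ))⁻¹ * B.map (Complex.ofReal : ℝ → ℂ)) 0 0

/-- The transfer function `h` is passive: `Re h(jω) ≥ 0` for all real `ω`. -/
def IsPassiveTransfer : Prop :=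
  ∀ ω : ℝ, 0 ≤ (transferFunction A B C (Complex.I * ω)).re

/-- The transfer function `h` is strictly passive: `Re h(jω) > 0` for all real `ω`. -/
def IsStrictlyPassiveTransfer : Prop :=
  ∀ ω : ℝ, 0 < (transferFunction A B C (Complex.I * ω)).re

/-- Controllability of `(A, B)`: the columns of `B, AB, A²B, …` span the state space. -/
def IsControllable : Prop :=
  Submodule.span ℝ (Set.range fun k : ℕ => (A ^ k * B).col 0) = ⊤

/-- The scalar predictor realization `x' = A x + B u`, `y = C x`. -/
def predictor : ControlSystem (Fin m → ℝ) (Fin 1 → ℝ) (Fin 1 → ℝ) where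
  dyn _ x u := A *ᵥ x + B *ᵥ u
  out _ x _ := C *ᵥ x

variable (n : ℕ)

/-- `A ⊗ Iₙ`. -/
def kronA : Matrix (Fin m × Fin n) (Fin m × Fin n) ℝ :=
  A ⊗ₖ (1 : Matrix (Fin n) (Fin n) ℝ)

/-- `B ⊗ Iₙ`, with the column index `Fin 1 × Fin n` identified with `Fin n`. -/
def kronB : Matrix (Fin m × Fin n) (Fin n) ℝ :=
  (B ⊗ₖ (1 : Matrix (Fin n) (Fin n) ℝ)).submatrix id (fun j => (0, j))

/-- `C ⊗ Iₙ`, with the row index `Fin 1 × Fin n` identified with `Fin n`. -/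
def kronC : Matrix (Fin n) (Fin m × Fin n) ℝ :=
  (C ⊗ₖ (1 : Matrix (Fin n) (Fin n) ℝ)).submatrix (fun i => (0, i)) id

/-- Predictive replicator dynamics with state `(r, x_h)`:
`r' = p`, `x_h' = (A ⊗ I) x_h + (B ⊗ I) p`, `x = σ(r + (C ⊗ I) x_h)`. -/
def predictiveRD :
    ControlSystem ((Fin n → ℝ) × (Fin m × Fin n → ℝ)) (Fin n → ℝ) (Fin n → ℝ) where
  dyn _ s p := (p, kronA A n *ᵥ s.2 + kronB B n *ᵥ p)
  out _ s _ := softmax (s.1 + kronC C n *ᵥ s.2)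

/-- The comparison system with state `(z_R, x_h)`: both dynamics are driven by the same payoff
with matched scores `r = z_R`, and the output is `y = x_PR - x_R = σ(z_R + m) - σ(z_R)`. -/
def comparisonSystem :
    ControlSystem ((Fin n → ℝ) × (Fin m × Fin n → ℝ)) (Fin n → ℝ) (Fin n → ℝ) where
  dyn := (predictiveRD A B C n).dyn
  out t s p := (predictiveRD A B C n).out t s p - (standardRD n).out t s.1 p

/-- The uniform payoff `p*(t) = 𝟏`. -/
def uniformPayoff : ℝ → Fin n → ℝ := fun _ => 1

/-- The score `z_R*(t) = t 𝟏` under the uniform payoff. -/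
def uniformScore : ℝ → Fin n → ℝ := fun t => t • 1

/-- The nominal state `(z_R*, x_h*)`, with `x_h* = ((-A)⁻¹ B) ⊗ 𝟏`. -/
def uniformState : ℝ → (Fin n → ℝ) × (Fin m × Fin n → ℝ) :=
  fun t => (uniformScore n t, fun ij => ((-A)⁻¹ * B) ij.1 0)

end Predictor

end

/-!
On the uniform trajectory all scores are equal, and there the derivative of softmax is `1/n` times
the projection `Π` along `𝟏` (`centering`). The linearized output of the comparison system is
therefore `Δy = (1/n) Π (C ⊗ I) ξ_h`. Since `Π` is an orthogonal projection that commutes with the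
predictor, the system splits into `n` copies of the scalar predictor `x' = A x + B u`, `y = C x`,
driven by the coordinates of `Π Δp` (`isTrajectory_centeredState`), and the energy `∫ Δpᵀ Δy` is
`1/n` times the sum of the energies that these copies absorb (`integral_linearized_supply`). The
payoff that predictive replicator dynamics gains over standard replicator dynamics is, to first
order, this same energy (`integral_payoff_predictive_eq`). Everything thus reduces to the scalar
predictor.

*Energy from rest.* The input is cut off at the horizon `T`, and the state then decays freely
because `A` is stable (`IsHurwitz.exists_decaying`, from generalized eigenvectors). Input and output
are now integrable and square integrable on `[0, ∞)`, the Fourier transform of the output is `h(iω)`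
times that of the input (`integral_cexp_output`), and Plancherel's theorem
(`integral_conj_mul_fourier`) turns the absorbed energy into `∫ Re h(2πiξ) |û(ξ)|² dξ` (`exists_integral_supply_eq`). This is
nonnegative for passive `h`; for strictly passive `h` it is positive unless `û`, and hence `u` on
`[0, T]`, vanishes almost everywhere.

*Storage function.* If `(A, B)` is controllable, the least energy `V x` with which the predictor can
be steered from rest to `x` (the required supply) is finite and nonnegative. Concatenating
trajectories gives the dissipation inequality. Superposing trajectories with a common horizon gives
homogeneity of degree two and the parallelogram law, so that `V` is a quadratic form and therefore
`C¹` (`contDiff_of_parallelogram_le`, `isPassive_predictor_of_isControllable`). A storage function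
of the predictor, summed over the copies, is one of the linearized comparison system
(`isPassive_linearize`).
-/

noncomputable section

/-! ### Plancherel's theorem for integrable functions -/

section Plancherel

open scoped FourierTransform ContDiff SchwartzMap InnerProductSpace

variable {f g : ℝ → ℂ}

/-- On `L¹ ∩ L²` the Fourier integral represents the `L²` Fourier transform: both have the same
pairing with every test function. -/
lemma fourier_toLp_ae_eq (hf : Integrable f) (hf2 : MemLp f 2) :
    (𝓕 (hf2.toLp f) : Lp ℂ 2 (volume : Measure ℝ)) =ᵐ[volume] 𝓕 f := by
  have hcont : Continuous (𝓕 f) :=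
    VectorFourier.fourierIntegral_continuous Real.continuous_fourierChar
      (by simpa using! continuous_inner) hf
  refine ae_eq_of_integral_contDiff_smul_eq ((Lp.memLp _).locallyIntegrable (by norm_num))
    hcont.locallyIntegrable fun φ hφ hφc => ?_
  have hφc' : HasCompactSupport (Complex.ofRealCLM ∘ φ) := hφc.comp_left rfl
  have hφ' : ContDiff ℝ ∞ (Complex.ofRealCLM ∘ φ) := by fun_prop
  let ψ : 𝓢(ℝ, ℂ) := hφc'.toSchwartzMap hφ'
  have hdist := congrArg (fun D => D ψ) (Lp.fourier_toTemperedDistribution_eq (hf2.toLp f))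
  simp only [TemperedDistribution.fourier_apply, Lp.toTemperedDistribution_apply] at hdist
  have hflip : ∫ ξ, 𝓕 (ψ : ℝ → ℂ) ξ • f ξ = ∫ ξ, ψ ξ • 𝓕 f ξ := by
    simpa using! VectorFourier.integral_bilin_fourierIntegral_eq_flip
      (ContinuousLinearMap.lsmul ℂ ℂ) (L := innerₗ ℝ)
      Real.continuous_fourierChar continuous_inner ψ.integrable hf
  calc ∫ x, φ x • (𝓕 (hf2.toLp f) : Lp ℂ 2 (volume : Measure ℝ)) x
      = ∫ x, ψ x • (𝓕 (hf2.toLp f) : Lp ℂ 2 (volume : Measure ℝ)) x := by simp [ψ]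
    _ = ∫ x, (𝓕 ψ) x • (hf2.toLp f) x := hdist.symm
    _ = ∫ x, 𝓕 (ψ : ℝ → ℂ) x • f x := by
        refine integral_congr_ae ?_
        filter_upwards [hf2.coeFn_toLp] with x hx
        rw [hx, SchwartzMap.fourier_coe]
    _ = ∫ x, φ x • 𝓕 f x := by rw [hflip]; simp [ψ]

lemma memLp_two_fourier (hf : Integrable f) (hf2 : MemLp f 2) : MemLp (𝓕 f) 2 :=
  (memLp_congr_ae (fourier_toLp_ae_eq hf hf2)).1 (Lp.memLp _)

lemma integral_conj_mul_fourier (hf : Integrable f) (hf2 : MemLp f 2)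
    (hg : Integrable g) (hg2 : MemLp g 2) :
    ∫ ξ, (starRingEnd ℂ) (𝓕 f ξ) * 𝓕 g ξ = ∫ t, (starRingEnd ℂ) (f t) * g t := by
  have h := Lp.inner_fourier_eq (hf2.toLp f) (hg2.toLp g)
  rw [L2.inner_def, L2.inner_def] at h
  calc _ = _ := integral_congr_ae ?_
    _ = _ := h
    _ = _ := integral_congr_ae ?_
  · filter_upwards [fourier_toLp_ae_eq hf hf2, fourier_toLp_ae_eq hg hg2] with ξ h1 h2
    rw [h1, h2, RCLike.inner_apply, mul_comm]
  · filter_upwards [hf2.coeFn_toLp, hg2.coeFn_toLp] with t h1 h2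
    rw [h1, h2, RCLike.inner_apply, mul_comm]

lemma ae_eq_zero_of_fourier_ae_eq_zero (hf : Integrable f) (hf2 : MemLp f 2)
    (h : 𝓕 f =ᵐ[volume] 0) : f =ᵐ[volume] 0 := by
  have h0 : (𝓕 (hf2.toLp f) : Lp ℂ 2 (volume : Measure ℝ)) = 0 :=
    (Lp.eq_zero_iff_ae_eq_zero).2 ((fourier_toLp_ae_eq hf hf2).trans h)
  have h1 : hf2.toLp f = 0 := by
    rw [← norm_eq_zero, ← Lp.norm_fourier_eq, h0, norm_zero]
  exact hf2.coeFn_toLp.symm.trans ((Lp.eq_zero_iff_ae_eq_zero).1 h1)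

end Plancherel

/-! ### Decaying solutions of stable linear equations -/

section Stable

open Filter Topology Set

/-- The scalar modes `t ↦ tʲ/j! · e^{μt}` from which solutions of linear equations are built. -/
def expMode (μ : ℂ) (j : ℕ) (t : ℝ) : ℂ := (t : ℂ) ^ j / (j.factorial : ℂ) * Complex.exp (μ * t)

lemma continuous_expMode (μ : ℂ) (j : ℕ) : Continuous (expMode μ j) := by
  unfold expMode; fun_prop

lemma hasDerivAt_cexp_mul_ofReal (μ : ℂ) (t : ℝ) :
    HasDerivAt (fun t : ℝ => Complex.exp (μ * t)) (μ * Complex.exp (μ * t)) t := by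
  have := ((Complex.ofRealCLM.hasDerivAt (x := t)).const_mul μ).cexp
  simpa [mul_comm] using this

lemma hasDerivAt_expMode_zero (μ : ℂ) (t : ℝ) :
    HasDerivAt (expMode μ 0) (μ * expMode μ 0 t) t := by
  have h : expMode μ 0 = fun t : ℝ => Complex.exp (μ * t) := by ext t; simp [expMode]
  rw [h]
  exact hasDerivAt_cexp_mul_ofReal μ t

lemma hasDerivAt_expMode_succ (μ : ℂ) (j : ℕ) (t : ℝ) :
    HasDerivAt (expMode μ (j + 1)) (μ * expMode μ (j + 1) t + expMode μ j t) t := by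
  have h1 : HasDerivAt (fun t : ℝ => (t : ℂ) ^ (j + 1) / ((j + 1).factorial : ℂ))
      ((t : ℂ) ^ j / (j.factorial : ℂ)) t := by
    have := ((Complex.ofRealCLM.hasDerivAt (x := t)).pow (j + 1)).div_const
      ((j + 1).factorial : ℂ)
    convert! this using 1
    have h2 : (j.factorial : ℂ) ≠ 0 := by exact_mod_cast j.factorial_ne_zero
    have h3 : (j : ℂ) + 1 ≠ 0 := by exact_mod_cast j.succ_ne_zero
    simp [Nat.factorial_succ]
    field_simp
  convert! h1.mul (hasDerivAt_cexp_mul_ofReal μ t) using 1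
  simp only [expMode]
  ring

lemma expMode_isBigO {μ : ℂ} (hμ : μ.re < 0) (j : ℕ) :
    expMode μ j =O[atTop] fun t : ℝ => Real.exp (-(-μ.re / 2) * t) := by
  have h1 : (fun t : ℝ => t ^ j) =O[atTop] fun t : ℝ => Real.exp ((-μ.re / 2) * t) :=
    (isLittleO_pow_exp_pos_mul_atTop j (by linarith)).isBigO
  have h2 := (h1.mul (Asymptotics.isBigO_refl (fun t : ℝ => Real.exp (μ.re * t)) atTop)
    ).const_mul_left ((j.factorial : ℝ)⁻¹)
  refine Asymptotics.isBigO_norm_left.1 ?_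
  refine (h2.norm_left.congr' (Eventually.of_forall fun t => ?_) (Eventually.of_forall fun t => ?_))
  · simp [expMode, Complex.norm_exp]; ring
  · simp only [← Real.exp_add]; ring_nf

lemma integrableOn_expMode {μ : ℂ} (hμ : μ.re < 0) (j : ℕ) :
    IntegrableOn (expMode μ j) (Ioi 0) :=
  (integrable_norm_iff (continuous_expMode μ j).aestronglyMeasurable).1
    (integrable_of_isBigO_exp_neg (b := -μ.re / 2) (by linarith)
      (continuous_expMode μ j).norm.continuousOn (expMode_isBigO hμ j).norm_left)

lemma tendsto_expMode {μ : ℂ} (hμ : μ.re < 0) (j : ℕ) :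
    Tendsto (expMode μ j) atTop (𝓝 0) := by
  refine (expMode_isBigO hμ j).trans_tendsto ?_
  have h : Tendsto (fun t : ℝ => (-μ.re / 2) * t) atTop atTop :=
    tendsto_id.const_mul_atTop (by linarith)
  refine (Real.tendsto_exp_neg_atTop_nhds_zero.comp h).congr fun t => ?_
  simp

variable {V : Type*} [NormedAddCommGroup V] [NormedSpace ℂ V]

/-- `f` solves `f' = F f` with `f 0 = v`, is integrable on `[0, ∞)` and tends to `0`. -/
structure IsDecayingSolution (F : V → V) (v : V) (f : ℝ → V) : Prop where
  map_zero : f 0 = v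
  hasDerivAt : ∀ t, HasDerivAt f (F (f t)) t
  integrableOn : IntegrableOn f (Ioi 0)
  tendsto : Tendsto f atTop (𝓝 0)

/-- The truncated exponential series `∑_{j ≤ k} tʲ/j! e^{μt} (F - μ)ʲ v` solves `f' = F f` up to
its last term. -/
lemma hasDerivAt_sum_expMode (F : Module.End ℂ V) (μ : ℂ) (v : V) (k : ℕ) (t : ℝ) :
    HasDerivAt (fun t => ∑ j ∈ Finset.range (k + 1), expMode μ j t • ((F - μ • 1) ^ j) v)
      (F (∑ j ∈ Finset.range (k + 1), expMode μ j t • ((F - μ • 1) ^ j) v) -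
        expMode μ k t • ((F - μ • 1) ^ (k + 1)) v) t := by
  have key : ∀ j : ℕ, F (((F - μ • 1) ^ j) v) =
      μ • ((F - μ • 1) ^ j) v + ((F - μ • 1) ^ (j + 1)) v := by
    intro j
    rw [pow_succ' _ j, Module.End.mul_apply]
    simp
  induction k with
  | zero =>
    have := (hasDerivAt_expMode_zero μ t).smul_const v
    convert! this using 1
    · simp
    · simp only [zero_add, Finset.sum_range_one, pow_zero, Module.End.one_apply, pow_one,
        map_smul, LinearMap.sub_apply, LinearMap.smul_apply]
      module
  | succ k ih =>
    simp_rw [Finset.sum_range_succ _ (k + 1)]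
    have := ih.add ((hasDerivAt_expMode_succ μ k t).smul_const (((F - μ • 1) ^ (k + 1)) v))
    convert! this using 1
    rw [map_add, map_smul, key (k + 1)]
    module

/-- The initial values of decaying solutions form a subspace; it contains every generalized
eigenvector, since there the exponential series is a finite sum of decaying modes. -/
lemma exists_isDecayingSolution [FiniteDimensional ℂ V] (F : Module.End ℂ V)
    (hF : ∀ μ ∈ spectrum ℂ F, μ.re < 0) (v : V) : ∃ f, IsDecayingSolution F v f := by
  let S : Submodule ℂ V :=
    { carrier := {v | ∃ f, IsDecayingSolution F v f}
      zero_mem' := ⟨fun _ => 0, rfl, fun t => by simpa using hasDerivAt_const t (0 : V),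
        integrableOn_zero, tendsto_const_nhds⟩
      add_mem' := by
        rintro a b ⟨f, hf⟩ ⟨g, hg⟩
        refine ⟨fun t => f t + g t, by rw [hf.map_zero, hg.map_zero], fun t => ?_,
          hf.integrableOn.add hg.integrableOn, by simpa using hf.tendsto.add hg.tendsto⟩
        rw [map_add]
        exact (hf.hasDerivAt t).add (hg.hasDerivAt t)
      smul_mem' := by
        rintro c a ⟨f, hf⟩
        refine ⟨fun t => c • f t, by rw [hf.map_zero], fun t => ?_,
          hf.integrableOn.smul c, by simpa using hf.tendsto.const_smul c⟩
        rw [map_smul]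
        exact (hf.hasDerivAt t).const_smul c }
  suffices h : (⊤ : Submodule ℂ V) ≤ S from h trivial
  rw [← Module.End.iSup_maxGenEigenspace_eq_top F]
  refine iSup_le fun μ v hv => ?_
  obtain ⟨k, hk⟩ := (Module.End.mem_maxGenEigenspace F μ v).1 hv
  by_cases hμ : F.HasEigenvalue μ
  · have hre : μ.re < 0 := hF μ (Module.End.hasEigenvalue_iff_mem_spectrum.1 hμ)
    refine ⟨fun t => ∑ j ∈ Finset.range (k + 1), expMode μ j t • ((F - μ • 1) ^ j) v,
      ?_, ?_, ?_, ?_⟩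
    · rw [Finset.sum_range_succ']
      simp [expMode]
    · intro t
      simpa [pow_succ', hk] using hasDerivAt_sum_expMode F μ v k t
    · exact integrable_finsetSum _ fun j _ => (integrableOn_expMode hre j).smul_const _
    · simpa using tendsto_finsetSum (Finset.range (k + 1)) fun j _ =>
        (tendsto_expMode hre j).smul_const (((F - μ • 1) ^ j) v)
  -- away from the eigenvalues the generalized eigenspace is trivial
  · have hinj : Function.Injective (F - μ • (1 : Module.End ℂ V)) := by
      rw [← LinearMap.ker_eq_bot]
      by_contra h
      refine hμ ?_
      rw [Module.End.hasEigenvalue_iff, Module.End.eigenspace_def]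
      simpa [Algebra.algebraMap_eq_smul_one] using h
    have hv0 : v = 0 := by
      have : Function.Injective ((F - μ • (1 : Module.End ℂ V)) ^ k) := by
        rw [Module.End.coe_pow]; exact hinj.iterate k
      exact this (by rw [hk, map_zero])
    rw [hv0]
    exact S.zero_mem

/-- Solutions of a real stable equation decay: they are real parts of complex ones. -/
lemma IsHurwitz.exists_decaying {m : ℕ} {A : Matrix (Fin m) (Fin m) ℝ} (hA : IsHurwitz A)
    (x : Fin m → ℝ) :
    ∃ f : ℝ → Fin m → ℝ, f 0 = x ∧ (∀ t, HasDerivAt f (A *ᵥ f t) t) ∧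
      IntegrableOn f (Ioi 0) ∧ Tendsto f atTop (𝓝 0) := by
  obtain ⟨f, hf⟩ := exists_isDecayingSolution
    (Matrix.toLin' (A.map (Complex.ofReal : ℝ → ℂ)))
    (by rw [Matrix.spectrum_toLin']; exact hA) (fun i => (x i : ℂ))
  let re : (Fin m → ℂ) →L[ℝ] (Fin m → ℝ) :=
    ContinuousLinearMap.pi fun i => Complex.reCLM.comp (ContinuousLinearMap.proj i)
  refine ⟨fun t => re (f t), ?_, fun t => ?_, re.integrable_comp hf.integrableOn, ?_⟩
  · ext i; simp [re, hf.map_zero]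
  · have := re.hasFDerivAt.comp_hasDerivAt t (hf.hasDerivAt t)
    convert! this using 1
    ext i
    simp [re, Matrix.mulVec, dotProduct]
  · simpa [Function.comp_def] using (re.continuous.tendsto 0).comp hf.tendsto

end Stable

/-! ### Trajectories -/

namespace ControlSystem

open Set

section Trajectory

variable {X U Y : Type*} [NormedAddCommGroup X] [NormedSpace ℝ X] {G : ControlSystem X U Y}
  {u : ℝ → U} {x : ℝ → X}

/-- Continuity is automatic: an indefinite integral is continuous. -/
lemma IsTrajectory.of_integral
    (h : ∀ t : ℝ, 0 ≤ t → IntervalIntegrable (fun τ => G.dyn τ (x τ) (u τ)) volume 0 t ∧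
      x t = x 0 + ∫ τ in (0 : ℝ)..t, G.dyn τ (x τ) (u τ)) : G.IsTrajectory u x := by
  refine ⟨fun t ht => ?_, h⟩
  have ht0 : (0 : ℝ) ≤ t := ht
  have hc : ContinuousOn x (Icc 0 (t + 1)) := by
    have h1 := intervalIntegral.continuousOn_primitive_interval' (h (t + 1) (by linarith)).1
      (left_mem_uIcc)
    rw [uIcc_of_le (by linarith)] at h1
    exact (continuousOn_const (c := x 0)).add h1 |>.congr fun s hs => (h s hs.1).2
  refine (hc t ⟨ht0, by linarith⟩).mono_of_mem_nhdsWithin ?_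
  filter_upwards [self_mem_nhdsWithin, mem_nhdsWithin_of_mem_nhds (Iio_mem_nhds (lt_add_one t))]
    with s h1 h2 using ⟨h1, h2.le⟩

/-- A continuous linear map that intertwines the right-hand sides maps trajectories to
trajectories. -/
lemma IsTrajectory.map {X' U' Y' : Type*} [NormedAddCommGroup X'] [NormedSpace ℝ X']
    [CompleteSpace X] [CompleteSpace X']
    {G' : ControlSystem X' U' Y'} {u' : ℝ → U'} (hx : G.IsTrajectory u x) (L : X →L[ℝ] X')
    (hL : ∀ t, L (G.dyn t (x t) (u t)) = G'.dyn t (L (x t)) (u' t)) :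
    G'.IsTrajectory u' (fun t => L (x t)) := by
  refine IsTrajectory.of_integral fun t ht => ?_
  obtain ⟨h1, h2⟩ := hx.2 t ht
  simp only [← hL]
  refine ⟨⟨L.integrable_comp h1.1, L.integrable_comp h1.2⟩, ?_⟩
  rw [L.intervalIntegral_comp_comm h1, ← map_add, ← h2]

end Trajectory

end ControlSystem

lemma IsLocallySquareIntegrable.zero {k : ℕ} :
    IsLocallySquareIntegrable (fun _ => 0 : ℝ → Fin k → ℝ) :=
  fun _ _ => MemLp.zero

lemma IsLocallySquareIntegrable.map {k l : ℕ} {u : ℝ → Fin k → ℝ}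
    (hu : IsLocallySquareIntegrable u) (L : (Fin k → ℝ) →L[ℝ] (Fin l → ℝ)) :
    IsLocallySquareIntegrable (fun t => L (u t)) :=
  fun T hT => L.comp_memLp' (hu T hT)

lemma IsLocallySquareIntegrable.add {k : ℕ} {u v : ℝ → Fin k → ℝ}
    (hu : IsLocallySquareIntegrable u) (hv : IsLocallySquareIntegrable v) :
    IsLocallySquareIntegrable (u + v) :=
  fun T hT => (hu T hT).add (hv T hT)

lemma IsLocallySquareIntegrable.intervalIntegrable {k : ℕ} {u : ℝ → Fin k → ℝ}
    (hu : IsLocallySquareIntegrable u) {T : ℝ} (hT : 0 ≤ T) :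
    IntervalIntegrable u volume 0 T := by
  rw [intervalIntegrable_iff_integrableOn_Icc_of_le hT]
  have h := (hu (T + 1) (by linarith)).integrable (by norm_num)
  exact IntegrableOn.mono_set h (Set.Icc_subset_Icc_right (by linarith))

lemma IsLocallySquareIntegrable.intervalIntegrable_dotProduct {k : ℕ} {u y : ℝ → Fin k → ℝ}
    (hu : IsLocallySquareIntegrable u) (hy : ContinuousOn y (Set.Ici 0)) {T : ℝ} (hT : 0 ≤ T) :
    IntervalIntegrable (fun t => u t ⬝ᵥ y t) volume 0 T := by
  have h1 := hu.intervalIntegrable hT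
  have hsum : (fun t => u t ⬝ᵥ y t) = ∑ i, fun t => u t i * y t i := by
    ext t; simp [dotProduct]
  rw [hsum]
  refine IntervalIntegrable.sum _ fun i _ => ?_
  have h2 : IntervalIntegrable (fun t => u t i) volume 0 T :=
    let L : (Fin k → ℝ) →L[ℝ] ℝ := ContinuousLinearMap.proj i
    ⟨L.integrable_comp h1.1, L.integrable_comp h1.2⟩
  refine h2.mul_continuousOn ?_
  rw [Set.uIcc_of_le hT]
  exact ((continuous_apply i).comp_continuousOn hy).mono Set.Icc_subset_Ici_self

/-- The signal that follows `a` up to time `S` and then `b`, started afresh. -/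
def concatAt {E : Type*} (S : ℝ) (a b : ℝ → E) : ℝ → E :=
  fun t => if t ≤ S then a t else b (t - S)

lemma concatAt_of_le {E : Type*} {S t : ℝ} (a b : ℝ → E) (h : t ≤ S) : concatAt S a b t = a t :=
  if_pos h

lemma concatAt_of_lt {E : Type*} {S t : ℝ} (a b : ℝ → E) (h : S < t) :
    concatAt S a b t = b (t - S) := if_neg h.not_ge

lemma concatAt_add {E : Type*} {S T : ℝ} {a b : ℝ → E} (hT : 0 ≤ T) (hab : b 0 = a S) :
    concatAt S a b (S + T) = b T := by
  rcases hT.eq_or_lt with rfl | h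
  · simp [concatAt, hab]
  · rw [concatAt_of_lt _ _ (by linarith)]; simp

lemma integral_concat {E : Type*} [NormedAddCommGroup E] [NormedSpace ℝ E] {S T : ℝ}
    {g a b : ℝ → E} (hS : 0 ≤ S) (hT : 0 ≤ T) (hga : ∀ t ≤ S, g t = a t)
    (hgb : ∀ t, S < t → g t = b (t - S)) (ha : IntervalIntegrable a volume 0 S)
    (hb : IntervalIntegrable b volume 0 T) :
    IntervalIntegrable g volume 0 (S + T) ∧
      ∫ t in (0 : ℝ)..(S + T), g t = (∫ t in (0 : ℝ)..S, a t) + ∫ t in (0 : ℝ)..T, b t := by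
  have h1 : IntervalIntegrable g volume 0 S := ha.congr fun t ht => by
    rw [Set.uIoc_of_le hS] at ht; exact (hga t ht.2).symm
  have hb' : IntervalIntegrable (fun t => b (t - S)) volume S (S + T) := by
    simpa [add_comm] using hb.comp_sub_right S
  have hcongr : ∀ t ∈ Set.uIoc S (S + T), b (t - S) = g t := fun t ht => by
    rw [Set.uIoc_of_le (by linarith)] at ht; exact (hgb t ht.1).symm
  have h2 : IntervalIntegrable g volume S (S + T) := hb'.congr hcongr
  refine ⟨h1.trans h2, ?_⟩
  rw [← intervalIntegral.integral_add_adjacent_intervals h1 h2]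
  congr 1
  · refine intervalIntegral.integral_congr fun t ht => ?_
    rw [Set.uIcc_of_le hS] at ht; exact hga t ht.2
  · rw [← intervalIntegral.integral_congr_ae (Filter.Eventually.of_forall hcongr),
      intervalIntegral.integral_comp_sub_right (fun t => b t)]
    simp

lemma IsLocallySquareIntegrable.concatAt {k : ℕ} {u v : ℝ → Fin k → ℝ}
    (hu : IsLocallySquareIntegrable u) (hv : IsLocallySquareIntegrable v) {S : ℝ} (hS : 0 ≤ S) :
    IsLocallySquareIntegrable (concatAt S u v) := by
  intro T hT
  have heq : _root_.concatAt S u v =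
      (Set.Iic S).indicator u + (Set.Ioi S).indicator (fun t => v (t - S)) := by
    ext1 t
    by_cases h : t ≤ S
    · simp [concatAt_of_le _ _ h, h]
    · simp [concatAt_of_lt _ _ (not_le.1 h), h, not_le.1 h]
  rw [heq]
  refine ((hu T hT).indicator measurableSet_Iic).add ?_
  rw [memLp_indicator_iff_restrict measurableSet_Ioi, Measure.restrict_restrict measurableSet_Ioi]
  have hp : MeasurePreserving (fun t : ℝ => t - S)
      (volume.restrict ((fun t : ℝ => t - S) ⁻¹' Set.Icc 0 T)) (volume.restrict (Set.Icc 0 T)) :=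
    (measurePreserving_sub_right volume S).restrict_preimage measurableSet_Icc
  refine ((hv T hT).comp_measurePreserving hp).mono_measure (Measure.restrict_mono ?_ le_rfl)
  rintro t ⟨h1, h2⟩
  have : S < t := h1
  exact ⟨by simpa using this.le, by linarith [h2.2]⟩

section Predictor

variable {m : ℕ} {A : Matrix (Fin m) (Fin m) ℝ} {B : Matrix (Fin m) (Fin 1) ℝ}
  {C : Matrix (Fin 1) (Fin m) ℝ} {u v : ℝ → Fin 1 → ℝ} {w f : ℝ → Fin m → ℝ}

lemma isTrajectory_predictor_concatAt (hw : (predictor A B C).IsTrajectory u w)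
    (hf : (predictor A B C).IsTrajectory v f) {S : ℝ} (hS : 0 ≤ S) (h : f 0 = w S) :
    (predictor A B C).IsTrajectory (concatAt S u v) (concatAt S w f) := by
  refine ControlSystem.IsTrajectory.of_integral fun t ht => ?_
  rcases le_or_gt t S with hts | hts
  · obtain ⟨h1, h2⟩ := hw.2 t ht
    have hcongr : ∀ τ ∈ Set.uIcc 0 t, (predictor A B C).dyn τ (w τ) (u τ) =
        (predictor A B C).dyn τ (concatAt S w f τ) (concatAt S u v τ) := by
      intro τ hτ
      rw [Set.uIcc_of_le ht] at hτ
      rw [concatAt_of_le _ _ (hτ.2.trans hts), concatAt_of_le _ _ (hτ.2.trans hts)]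
    refine ⟨h1.congr fun τ hτ => hcongr τ (Set.uIoc_subset_uIcc hτ), ?_⟩
    rw [← intervalIntegral.integral_congr hcongr, concatAt_of_le _ _ hts, concatAt_of_le _ _ hS, h2]
  · obtain ⟨h1, h2⟩ := hw.2 S hS
    obtain ⟨h3, h4⟩ := hf.2 (t - S) (by linarith)
    obtain ⟨h5, h6⟩ := integral_concat (S := S) (T := t - S)
      (g := fun τ => (predictor A B C).dyn τ (concatAt S w f τ) (concatAt S u v τ)) hS
      (by linarith)
      (fun τ hτ => by rw [concatAt_of_le _ _ hτ, concatAt_of_le _ _ hτ])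
      (fun τ hτ => by rw [concatAt_of_lt _ _ hτ, concatAt_of_lt _ _ hτ]; rfl) h1 h3
    rw [add_sub_cancel] at h5 h6
    refine ⟨h5, ?_⟩
    rw [h6, concatAt_of_lt _ _ hts, concatAt_of_le _ _ hS, h4, h, h2, add_assoc]

lemma intervalIntegrable_supply (hu : IsLocallySquareIntegrable u)
    (hw : (predictor A B C).IsTrajectory u w) {T : ℝ} (hT : 0 ≤ T) :
    IntervalIntegrable (fun t => u t ⬝ᵥ C *ᵥ w t) volume 0 T :=
  hu.intervalIntegrable_dotProduct
    ((Continuous.matrix_mulVec continuous_const continuous_id).comp_continuousOn hw.1) hT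

lemma integral_supply_concatAt (hu : IsLocallySquareIntegrable u)
    (hv : IsLocallySquareIntegrable v) (hw : (predictor A B C).IsTrajectory u w)
    (hf : (predictor A B C).IsTrajectory v f) {S T : ℝ} (hS : 0 ≤ S) (hT : 0 ≤ T) :
    ∫ t in (0 : ℝ)..(S + T), concatAt S u v t ⬝ᵥ C *ᵥ concatAt S w f t =
      (∫ t in (0 : ℝ)..S, u t ⬝ᵥ C *ᵥ w t) + ∫ t in (0 : ℝ)..T, v t ⬝ᵥ C *ᵥ f t :=
  (integral_concat hS hT
    (fun τ hτ => by rw [concatAt_of_le _ _ hτ, concatAt_of_le _ _ hτ])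
    (fun τ hτ => by rw [concatAt_of_lt _ _ hτ, concatAt_of_lt _ _ hτ])
    (intervalIntegrable_supply hu hw hS) (intervalIntegrable_supply hv hf hT)).2

/-- Classical solutions driven by a constant input are trajectories. -/
lemma isTrajectory_predictor_of_hasDerivAt (c : Fin 1 → ℝ)
    (hf : ∀ t, HasDerivAt f (A *ᵥ f t + B *ᵥ c) t) :
    (predictor A B C).IsTrajectory (fun _ => c) f := by
  have hcont : Continuous f := continuous_iff_continuousAt.2 fun t => (hf t).continuousAt
  have hint : ∀ t : ℝ, IntervalIntegrable (fun τ => A *ᵥ f τ + B *ᵥ c) volume 0 t := fun t =>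
    ((Continuous.matrix_mulVec continuous_const hcont).add continuous_const).intervalIntegrable _ _
  refine ⟨hcont.continuousOn, fun t _ => ⟨hint t, ?_⟩⟩
  have := intervalIntegral.integral_eq_sub_of_hasDerivAt (fun τ _ => hf τ) (hint t)
  change f t = f 0 + ∫ τ in (0 : ℝ)..t, (A *ᵥ f τ + B *ᵥ c)
  rw [this]; abel

end Predictor

/-! ### The predictor in the frequency domain -/

section FourierLaplace

open Filter Topology Set

/-- Integration by parts against the indefinite integral of an integrable function. -/
lemma integral_mul_eq_sub_integral_deriv_mul_primitive {φ g y : ℝ → ℝ} {N : ℝ}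
    (hφ : ContDiff ℝ 1 φ) (hg : IntervalIntegrable g volume 0 N) (hN : 0 ≤ N)
    (hy : ∀ t ∈ Icc 0 N, y t = ∫ s in (0 : ℝ)..t, g s) :
    ∫ t in (0 : ℝ)..N, φ t * g t = φ N * y N - ∫ t in (0 : ℝ)..N, deriv φ t * y t := by
  have h1 : AbsolutelyContinuousOnInterval φ 0 N := hφ.contDiffOn.absolutelyContinuousOnInterval
  have h2 := hg.absolutelyContinuousOnInterval_intervalIntegral (c := 0) left_mem_uIcc
  have h3 := h1.integral_mul_deriv_eq_deriv_mul h2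
  rw [intervalIntegral.integral_same, mul_zero, sub_zero, ← hy N ⟨hN, le_rfl⟩] at h3
  have h4 : ∫ t in (0 : ℝ)..N, φ t * deriv (fun x => ∫ v in (0 : ℝ)..x, g v) t =
      ∫ t in (0 : ℝ)..N, φ t * g t := by
    refine intervalIntegral.integral_congr_ae ?_
    filter_upwards [hg.ae_hasDerivAt_integral] with t ht hmem
    rw [(ht (uIoc_subset_uIcc hmem) 0 left_mem_uIcc).deriv]
  rw [h4] at h3
  rw [h3]
  congr 1
  refine intervalIntegral.integral_congr fun t ht => ?_
  rw [uIcc_of_le hN] at ht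
  simp only [hy t ht]

lemma cexp_neg_I_mul_ofReal (ω t : ℝ) :
    Complex.exp (-(Complex.I * ω) * t) =
      ((Real.cos (ω * t) : ℝ) : ℂ) - Complex.I * ((Real.sin (ω * t) : ℝ) : ℂ) := by
  have h : -(Complex.I * ω) * t = ((-(ω * t) : ℝ) : ℂ) * Complex.I := by push_cast; ring
  rw [h, Complex.exp_mul_I, ← Complex.ofReal_cos, ← Complex.ofReal_sin, Real.cos_neg, Real.sin_neg]
  push_cast; ring

/-- The finite-horizon form of the rule that differentiation becomes multiplication by `iω`. -/
lemma integral_cexp_mul_of_primitive {g y : ℝ → ℝ} {N : ℝ} (ω : ℝ) (hN : 0 ≤ N)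
    (hg : IntervalIntegrable g volume 0 N)
    (hy : ∀ t ∈ Icc 0 N, y t = ∫ s in (0 : ℝ)..t, g s) :
    ∫ t in (0 : ℝ)..N, Complex.exp (-(Complex.I * ω) * t) * (g t : ℂ) =
      Complex.exp (-(Complex.I * ω) * N) * (y N : ℂ) +
        Complex.I * ω * ∫ t in (0 : ℝ)..N, Complex.exp (-(Complex.I * ω) * t) * (y t : ℂ) := by
  have hyi : IntervalIntegrable y volume 0 N := by
    have h := intervalIntegral.continuousOn_primitive_interval' hg left_mem_uIcc
    refine (h.congr fun t ht => ?_).intervalIntegrable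
    rw [uIcc_of_le hN] at ht
    exact hy t ht
  have hsplit : ∀ k : ℝ → ℝ, IntervalIntegrable k volume 0 N →
      ∫ t in (0 : ℝ)..N, Complex.exp (-(Complex.I * ω) * t) * (k t : ℂ) =
        ((∫ t in (0 : ℝ)..N, Real.cos (ω * t) * k t : ℝ) : ℂ) -
          Complex.I * ((∫ t in (0 : ℝ)..N, Real.sin (ω * t) * k t : ℝ) : ℂ) := by
    intro k hk
    have hc : IntervalIntegrable (fun t => ((Real.cos (ω * t) * k t : ℝ) : ℂ)) volume 0 N :=
      have h : IntervalIntegrable (fun t => Real.cos (ω * t) * k t) volume 0 N :=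
        hk.continuousOn_mul (by fun_prop)
      ⟨h.1.ofReal, h.2.ofReal⟩
    have hs : IntervalIntegrable (fun t => ((Real.sin (ω * t) * k t : ℝ) : ℂ)) volume 0 N :=
      have h : IntervalIntegrable (fun t => Real.sin (ω * t) * k t) volume 0 N :=
        hk.continuousOn_mul (by fun_prop)
      ⟨h.1.ofReal, h.2.ofReal⟩
    rw [← intervalIntegral.integral_ofReal, ← intervalIntegral.integral_ofReal,
      ← intervalIntegral.integral_const_mul, ← intervalIntegral.integral_sub hc (hs.const_mul _)]
    refine intervalIntegral.integral_congr fun t _ => ?_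
    simp only [cexp_neg_I_mul_ofReal]
    push_cast; ring
  have hdc : deriv (fun t => Real.cos (ω * t)) = fun t => -(ω * Real.sin (ω * t)) := by
    ext t
    have := ((hasDerivAt_id t).const_mul ω).cos
    simpa [mul_comm] using this.deriv
  have hds : deriv (fun t => Real.sin (ω * t)) = fun t => ω * Real.cos (ω * t) := by
    ext t
    have := ((hasDerivAt_id t).const_mul ω).sin
    simpa [mul_comm] using this.deriv
  have h1 := integral_mul_eq_sub_integral_deriv_mul_primitive
    (φ := fun t => Real.cos (ω * t)) (by fun_prop) hg hN hy
  have h2 := integral_mul_eq_sub_integral_deriv_mul_primitive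
    (φ := fun t => Real.sin (ω * t)) (by fun_prop) hg hN hy
  simp only [hdc, hds, neg_mul, mul_assoc, intervalIntegral.integral_neg,
    intervalIntegral.integral_const_mul] at h1 h2
  rw [hsplit g hg, hsplit y hyi, h1, h2, cexp_neg_I_mul_ofReal]
  push_cast
  linear_combination ((ω : ℂ) * ↑(∫ t in (0 : ℝ)..N, Real.sin (ω * t) * y t)) * Complex.I_sq

lemma integrableOn_cexp_mul {k : ℝ → ℝ} (ω : ℝ) (hk : IntegrableOn k (Ioi 0)) :
    IntegrableOn (fun t : ℝ => Complex.exp (-(Complex.I * ω) * t) * (k t : ℂ)) (Ioi 0) := by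
  refine (hk.ofReal (𝕜 := ℂ)).bdd_mul (c := 1) (by fun_prop) (Eventually.of_forall fun t => ?_)
  simp [Complex.norm_exp]

/-- Differentiation becomes multiplication by `iω` under the Fourier transform on `[0, ∞)`. -/
lemma integral_Ioi_cexp_mul_of_primitive {g y : ℝ → ℝ} (ω : ℝ)
    (hg : IntegrableOn g (Ioi 0)) (hyint : IntegrableOn y (Ioi 0)) (hy0 : Tendsto y atTop (𝓝 0))
    (hy : ∀ t, 0 ≤ t → y t = ∫ s in (0 : ℝ)..t, g s) :
    ∫ t in Ioi (0 : ℝ), Complex.exp (-(Complex.I * ω) * t) * (g t : ℂ) =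
      Complex.I * ω * ∫ t in Ioi (0 : ℝ), Complex.exp (-(Complex.I * ω) * t) * (y t : ℂ) := by
  have h1 := intervalIntegral_tendsto_integral_Ioi 0 (integrableOn_cexp_mul ω hg) tendsto_id
  have h2 := intervalIntegral_tendsto_integral_Ioi 0 (integrableOn_cexp_mul ω hyint) tendsto_id
  have h3 : Tendsto (fun N : ℝ => Complex.exp (-(Complex.I * ω) * N) * (y N : ℂ)) atTop (𝓝 0) := by
    rw [tendsto_zero_iff_norm_tendsto_zero]
    simpa [Complex.norm_exp] using hy0.abs
  have h4 := h3.add (h2.const_mul (Complex.I * ω))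
  rw [zero_add] at h4
  refine tendsto_nhds_unique (h1.congr' ?_) h4
  filter_upwards [eventually_ge_atTop 0] with N hN
  exact integral_cexp_mul_of_primitive ω hN
    ((intervalIntegrable_iff_integrableOn_Ioc_of_le hN).2 (hg.mono_set Ioc_subset_Ioi_self))
    fun t ht => hy t ht.1

end FourierLaplace

section Hurwitz

variable {m : ℕ} {A : Matrix (Fin m) (Fin m) ℝ}

lemma IsHurwitz.isUnit_resolvent (hA : IsHurwitz A) {s : ℂ} (hs : 0 ≤ s.re) :
    IsUnit (s • (1 : Matrix (Fin m) (Fin m) ℂ) - A.map (Complex.ofReal : ℝ → ℂ)) := by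
  by_contra h
  have : s ∈ spectrum ℂ (A.map (Complex.ofReal : ℝ → ℂ)) := by
    rw [spectrum.mem_iff, Algebra.algebraMap_eq_smul_one]; exact h
  exact absurd (hA s this) (not_lt.2 hs)

lemma IsHurwitz.isUnit_det (hA : IsHurwitz A) : IsUnit A.det := by
  have h := hA.isUnit_resolvent (s := 0) le_rfl
  rw [zero_smul, zero_sub, IsUnit.neg_iff, Matrix.isUnit_iff_isUnit_det, isUnit_iff_ne_zero] at h
  rw [isUnit_iff_ne_zero]
  intro h0
  have h2 : (A.map (Complex.ofReal : ℝ → ℂ)).det = ((A.det : ℝ) : ℂ) :=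
    (RingHom.map_det Complex.ofRealHom A).symm
  exact h (by rw [h2, h0, Complex.ofReal_zero])

end Hurwitz

section Transfer

open Filter Topology Set

variable {m : ℕ} {A : Matrix (Fin m) (Fin m) ℝ} {B : Matrix (Fin m) (Fin 1) ℝ}
  {C : Matrix (Fin 1) (Fin m) ℝ} {u : ℝ → Fin 1 → ℝ} {w : ℝ → Fin m → ℝ}

/-- In the frequency domain the output of the predictor started at rest is `h(iω)` times its
input. -/
lemma integral_cexp_output (hA : IsHurwitz A) (hw : (predictor A B C).IsTrajectory u w)
    (hw0 : w 0 = 0) (hu : IntegrableOn u (Ioi 0)) (hwint : IntegrableOn w (Ioi 0))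
    (hwlim : Tendsto w atTop (𝓝 0)) (ω : ℝ) :
    ∫ t in Ioi (0 : ℝ), Complex.exp (-(Complex.I * ω) * t) * (((C *ᵥ w t) 0 : ℝ) : ℂ) =
      transferFunction A B C (Complex.I * ω) *
        ∫ t in Ioi (0 : ℝ), Complex.exp (-(Complex.I * ω) * t) * ((u t 0 : ℝ) : ℂ) := by
  have hui : IntegrableOn (fun t => u t 0) (Ioi 0) := hu.eval 0
  have hwi : ∀ i, IntegrableOn (fun t => w t i) (Ioi 0) := fun i => hwint.eval i
  set What : Fin m → ℂ := fun i =>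
    ∫ t in Ioi (0 : ℝ), Complex.exp (-(Complex.I * ω) * t) * ((w t i : ℝ) : ℂ) with hWhat
  set Uhat : ℂ := ∫ t in Ioi (0 : ℝ), Complex.exp (-(Complex.I * ω) * t) * ((u t 0 : ℝ) : ℂ)
  set Ac := A.map (Complex.ofReal : ℝ → ℂ)
  set Bc := B.map (Complex.ofReal : ℝ → ℂ)
  set Cc := C.map (Complex.ofReal : ℝ → ℂ)
  -- the Fourier transform commutes with constant linear combinations
  have hlin : ∀ c : Fin m → ℝ, ∫ t in Ioi (0 : ℝ), Complex.exp (-(Complex.I * ω) * t) *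
      ((c ⬝ᵥ w t : ℝ) : ℂ) = ∑ i, (c i : ℂ) * What i := by
    intro c
    simp_rw [hWhat, ← integral_const_mul]
    rw [← integral_finsetSum _ fun i _ => (integrableOn_cexp_mul ω (hwi i)).const_mul _]
    refine integral_congr_ae (Eventually.of_forall fun t => ?_)
    simp only [dotProduct, Complex.ofReal_sum, Finset.mul_sum, Complex.ofReal_mul]
    exact Finset.sum_congr rfl fun i _ => by ring
  have hdot : ∀ c : Fin m → ℝ, IntegrableOn (fun t => c ⬝ᵥ w t) (Ioi 0) := fun c =>
    integrable_finsetSum _ fun i _ => (hwi i).const_mul (c i)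
  -- the state equation `A Ŵ + B Û = iω Ŵ`, row by row
  have hstate : ∀ i, ∑ j, (A i j : ℂ) * What j + (B i 0 : ℂ) * Uhat = Complex.I * ω * What i := by
    intro i
    have hg : IntegrableOn (fun t => A i ⬝ᵥ w t + B i 0 * u t 0) (Ioi 0) :=
      (hdot (A i)).add (hui.const_mul _)
    have hprim : ∀ t, 0 ≤ t → w t i = ∫ s in (0 : ℝ)..t, (A i ⬝ᵥ w s + B i 0 * u s 0) := by
      intro t ht
      obtain ⟨h1, h2⟩ := hw.2 t ht
      have h3 := (ContinuousLinearMap.proj (R := ℝ)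
        (φ := fun _ : Fin m => ℝ) i).intervalIntegral_comp_comm h1
      rw [hw0, zero_add] at h2
      rw [h2]
      refine h3.symm.trans (intervalIntegral.integral_congr fun s _ => ?_)
      simp [predictor, Matrix.mulVec, dotProduct]
    have h := integral_Ioi_cexp_mul_of_primitive ω hg (hwi i)
      (((continuous_apply i).tendsto _).comp hwlim) hprim
    rw [← h, ← hlin (A i), ← integral_const_mul, ← integral_add (integrableOn_cexp_mul ω (hdot _))
      ((integrableOn_cexp_mul ω hui).const_mul _)]
    refine integral_congr_ae (Eventually.of_forall fun t => ?_)
    simp only []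
    push_cast; ring
  have hunit := hA.isUnit_resolvent (s := Complex.I * ω) (by simp)
  set R := (Complex.I * ω) • (1 : Matrix (Fin m) (Fin m) ℂ) - Ac with hR
  have hvec : R *ᵥ What = Bc *ᵥ (fun _ => Uhat) := by
    rw [hR, Matrix.sub_mulVec, Matrix.smul_mulVec, Matrix.one_mulVec, sub_eq_iff_eq_add]
    ext i
    have := hstate i
    simp only [Pi.smul_apply, smul_eq_mul, ← this, Pi.add_apply]
    simp [Matrix.mulVec, dotProduct, Ac, Bc]; ring
  have hsol : What = (R⁻¹ * Bc) *ᵥ (fun _ => Uhat) := by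
    rw [← Matrix.mulVec_mulVec, ← hvec, Matrix.mulVec_mulVec,
      Matrix.nonsing_inv_mul _ ((Matrix.isUnit_iff_isUnit_det _).1 hunit), Matrix.one_mulVec]
  calc _ = ∑ i, (C 0 i : ℂ) * What i := hlin (C 0)
    _ = (Cc *ᵥ What) 0 := by simp [Matrix.mulVec, dotProduct, Cc]
    _ = _ := by
      rw [hsol, Matrix.mulVec_mulVec, ← Matrix.mul_assoc]
      simp [Matrix.mulVec, dotProduct, transferFunction, R, Ac, Bc, Cc]

end Transfer

/-! ### The energy absorbed from rest -/

section InputOutput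

open Filter Topology Set
open scoped FourierTransform

lemma fourier_indicator_Ioi (k : ℝ → ℂ) (ξ : ℝ) :
    𝓕 ((Ioi (0 : ℝ)).indicator k) ξ =
      ∫ t in Ioi (0 : ℝ), Complex.exp (-(Complex.I * ((2 * Real.pi * ξ : ℝ) : ℂ)) * t) * k t := by
  rw [Real.fourier_real_eq_integral_exp_smul, ← integral_indicator measurableSet_Ioi]
  refine integral_congr_ae (Eventually.of_forall fun t => ?_)
  by_cases h : t ∈ Ioi (0 : ℝ)
  · simp only [indicator_of_mem h, smul_eq_mul]
    congr 2
    push_cast; ring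
  · simp only [indicator_of_notMem h, smul_zero]

/-- A continuous function on `[0, ∞)` that is integrable and tends to `0` is square integrable. -/
lemma memLp_two_of_tendsto_zero {y : ℝ → ℝ} (hc : ContinuousOn y (Ici 0))
    (hi : IntegrableOn y (Ioi 0)) (h0 : Tendsto y atTop (𝓝 0)) :
    MemLp y 2 (volume.restrict (Ioi 0)) := by
  obtain ⟨M, hM⟩ : ∃ M : ℝ, ∀ t, 0 ≤ t → ‖y t‖ ≤ M := by
    obtain ⟨N, hN⟩ := eventually_atTop.1 (h0.norm.eventually_le_const (u := 1) (by simp))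
    obtain ⟨M, hM⟩ := isCompact_Icc.exists_bound_of_continuousOn
      (hc.mono (fun t (ht : t ∈ Icc 0 N) => ht.1))
    refine ⟨max M 1, fun t ht => ?_⟩
    rcases le_total t N with h | h
    · exact (hM t ⟨ht, h⟩).trans (le_max_left _ _)
    · exact (hN t h).trans (le_max_right _ _)
  rw [memLp_two_iff_integrable_sq hi.aestronglyMeasurable]
  have : IntegrableOn (fun t => y t * y t) (Ioi 0) := by
    refine hi.bdd_mul (c := M) hi.aestronglyMeasurable ?_
    filter_upwards [ae_restrict_mem measurableSet_Ioi] with t ht using hM t (le_of_lt ht)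
  simp only [sq]
  exact this

variable {m : ℕ} {A : Matrix (Fin m) (Fin m) ℝ} {B : Matrix (Fin m) (Fin 1) ℝ}
  {C : Matrix (Fin 1) (Fin m) ℝ} {u : ℝ → Fin 1 → ℝ} {w : ℝ → Fin m → ℝ}

/-- The energy absorbed by the predictor started at rest, in the frequency domain. The input is cut
off at the horizon, after which the state decays freely; Plancherel's theorem then applies. -/
lemma exists_integral_supply_eq (hA : IsHurwitz A) (hu : IsLocallySquareIntegrable u)
    (hw : (predictor A B C).IsTrajectory u w) (hw0 : w 0 = 0) {T : ℝ} (hT : 0 ≤ T) :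
    ∃ Uhat : ℝ → ℂ,
      Integrable (fun ξ : ℝ =>
        (transferFunction A B C (Complex.I * ((2 * Real.pi * ξ : ℝ) : ℂ))).re * ‖Uhat ξ‖ ^ 2) ∧
      ∫ t in (0 : ℝ)..T, u t ⬝ᵥ C *ᵥ w t =
        ∫ ξ, (transferFunction A B C (Complex.I * ((2 * Real.pi * ξ : ℝ) : ℂ))).re *
          ‖Uhat ξ‖ ^ 2 ∧
      (Uhat =ᵐ[volume] 0 → ∀ᵐ t ∂(volume.restrict (Icc 0 T)), u t = 0) := by
  obtain ⟨f, hf0, hfd, hfi, hflim⟩ := hA.exists_decaying (w T)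
  have hftraj : (predictor A B C).IsTrajectory (fun _ => 0) f :=
    isTrajectory_predictor_of_hasDerivAt 0 fun t => by simpa using hfd t
  have htraj := isTrajectory_predictor_concatAt hw hftraj hT hf0
  set U := concatAt T u (fun _ => 0) with hU
  set W := concatAt T w f with hW
  have hUz : ∀ t, T < t → U t = 0 := fun t ht => concatAt_of_lt _ _ ht
  have hUloc : IsLocallySquareIntegrable U := hu.concatAt .zero hT
  -- the truncated input is globally integrable and square integrable
  have hUind : (Ioi (0 : ℝ)).indicator U = (Ioc (0 : ℝ) T).indicator U := by
    ext1 t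
    by_cases h1 : t ∈ Ioi (0 : ℝ)
    · by_cases h2 : t ≤ T
      · rw [indicator_of_mem h1, indicator_of_mem (show t ∈ Ioc 0 T from ⟨h1, h2⟩)]
      · rw [indicator_of_mem h1, indicator_of_notMem (fun h : t ∈ Ioc 0 T => h2 h.2),
          hUz t (not_le.1 h2)]
    · rw [indicator_of_notMem h1, indicator_of_notMem (fun h : t ∈ Ioc 0 T => h1 h.1)]
  have hUint : IntegrableOn U (Ioi 0) := by
    rw [← integrable_indicator_iff measurableSet_Ioi, hUind,
      integrable_indicator_iff measurableSet_Ioc]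
    exact (hUloc.intervalIntegrable hT).1
  have hU2 : MemLp U 2 (volume.restrict (Ioi 0)) := by
    rw [← memLp_indicator_iff_restrict measurableSet_Ioi, hUind,
      memLp_indicator_iff_restrict measurableSet_Ioc]
    refine (hUloc (T + 1) (by linarith)).mono_measure (Measure.restrict_mono ?_ le_rfl)
    exact fun t ht => ⟨ht.1.le, by linarith [ht.2]⟩
  have hWint : IntegrableOn W (Ioi 0) := by
    rw [← Ioc_union_Ioi_eq_Ioi hT]
    refine IntegrableOn.union ?_ ?_
    · exact ((htraj.1.mono Icc_subset_Ici_self).integrableOn_Icc).mono_set Ioc_subset_Icc_self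
    · have h1 : IntegrableOn (fun t => f (t - T)) (Ioi T) := by
        have := (((measurePreserving_sub_right volume T).integrableOn_comp_preimage
          (MeasurableEquiv.subRight T).measurableEmbedding)).2 hfi
        simpa [Function.comp_def] using this
      exact h1.congr_fun (fun t ht => (concatAt_of_lt _ _ ht).symm) measurableSet_Ioi
  have hWlim : Tendsto W atTop (𝓝 0) := by
    refine (hflim.comp (tendsto_atTop_add_const_right atTop (-T) tendsto_id)).congr' ?_
    filter_upwards [eventually_gt_atTop T] with t ht
    rw [hW, concatAt_of_lt _ _ ht]; simp [sub_eq_add_neg]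
  have hW0 : W 0 = 0 := by rw [hW, concatAt_of_le _ _ hT, hw0]
  -- complex-valued input and output on the whole line, zero for negative times
  set Uc : ℝ → ℂ := (Ioi (0 : ℝ)).indicator fun t => ((U t 0 : ℝ) : ℂ) with hUc
  set Yc : ℝ → ℂ := (Ioi (0 : ℝ)).indicator fun t => (((C *ᵥ W t) 0 : ℝ) : ℂ) with hYc
  let L : (Fin m → ℝ) →L[ℝ] ℝ :=
    (ContinuousLinearMap.proj 0).comp (Matrix.toLin' C).toContinuousLinearMap
  have hL : ∀ x, L x = (C *ᵥ x) 0 := fun x => by simp [L]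
  have hYint : IntegrableOn (fun t => (C *ᵥ W t) 0) (Ioi 0) := by
    simp_rw [← hL]; exact L.integrable_comp hWint
  have hYlim : Tendsto (fun t => (C *ᵥ W t) 0) atTop (𝓝 0) := by
    simp_rw [← hL]; simpa [Function.comp_def] using (L.continuous.tendsto 0).comp hWlim
  have hYcont : ContinuousOn (fun t => (C *ᵥ W t) 0) (Ici 0) := by
    simp_rw [← hL]; exact L.continuous.comp_continuousOn htraj.1
  have hUc1 : Integrable Uc := (integrable_indicator_iff measurableSet_Ioi).2 (hUint.eval 0).ofReal
  have hYc1 : Integrable Yc := (integrable_indicator_iff measurableSet_Ioi).2 hYint.ofReal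
  have hUc2 : MemLp Uc 2 := (memLp_indicator_iff_restrict measurableSet_Ioi).2 (hU2.eval 0).ofReal
  have hYc2 : MemLp Yc 2 := (memLp_indicator_iff_restrict measurableSet_Ioi).2
    (memLp_two_of_tendsto_zero hYcont hYint hYlim).ofReal
  have htransfer : ∀ ξ, 𝓕 Yc ξ =
      transferFunction A B C (Complex.I * ((2 * Real.pi * ξ : ℝ) : ℂ)) * 𝓕 Uc ξ := fun ξ => by
    rw [hYc, hUc, fourier_indicator_Ioi, fourier_indicator_Ioi]
    exact integral_cexp_output hA htraj hW0 hUint hWint hWlim _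
  have hre : ∀ ξ, ((starRingEnd ℂ) (𝓕 Uc ξ) * 𝓕 Yc ξ).re =
      (transferFunction A B C (Complex.I * ((2 * Real.pi * ξ : ℝ) : ℂ))).re * ‖𝓕 Uc ξ‖ ^ 2 := by
    intro ξ
    rw [htransfer, mul_left_comm, Complex.conj_mul', ← Complex.ofReal_pow, Complex.re_mul_ofReal]
  have hint : Integrable fun ξ => (starRingEnd ℂ) (𝓕 Uc ξ) * 𝓕 Yc ξ :=
    (memLp_two_fourier hUc1 hUc2).star.integrable_mul (memLp_two_fourier hYc1 hYc2)
  refine ⟨𝓕 Uc, ?_, ?_, fun h => ?_⟩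
  · exact hint.re.congr (Eventually.of_forall hre)
  · have hpl := integral_conj_mul_fourier hUc1 hUc2 hYc1 hYc2
    -- beyond the horizon the input vanishes, so the pairing is the energy absorbed up to `T`
    have hleft : ∫ t, (starRingEnd ℂ) (Uc t) * Yc t =
        ((∫ t in (0 : ℝ)..T, u t ⬝ᵥ C *ᵥ w t : ℝ) : ℂ) := by
      rw [intervalIntegral.integral_of_le hT, ← integral_indicator measurableSet_Ioc,
        ← integral_complex_ofReal]
      refine integral_congr_ae (Eventually.of_forall fun t => ?_)
      simp only [hUc, hYc]
      by_cases h1 : t ∈ Ioi (0 : ℝ)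
      · by_cases h2 : t ≤ T
        · rw [indicator_of_mem h1, indicator_of_mem h1,
            indicator_of_mem (show t ∈ Ioc 0 T from ⟨h1, h2⟩), hU, hW, concatAt_of_le _ _ h2,
            concatAt_of_le _ _ h2]
          simp [dotProduct]
        · rw [indicator_of_mem h1, indicator_of_notMem (fun h : t ∈ Ioc 0 T => h2 h.2),
            hUz t (not_le.1 h2)]
          simp
      · rw [indicator_of_notMem h1, indicator_of_notMem (fun h : t ∈ Ioc 0 T => h1 h.1)]
        simp
    rw [hleft] at hpl
    have h1 : (∫ ξ, (starRingEnd ℂ) (𝓕 Uc ξ) * 𝓕 Yc ξ).re =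
        ∫ ξ, ((starRingEnd ℂ) (𝓕 Uc ξ) * 𝓕 Yc ξ).re := (integral_re hint).symm
    rw [hpl, Complex.ofReal_re] at h1
    rw [h1]
    exact integral_congr_ae (Eventually.of_forall hre)
  · have h1 := ae_eq_zero_of_fourier_ae_eq_zero hUc1 hUc2 h
    rw [← restrict_Ioc_eq_restrict_Icc, ae_restrict_iff' measurableSet_Ioc]
    filter_upwards [h1] with t ht hmem
    rw [hUc, indicator_of_mem (show t ∈ Ioi (0 : ℝ) from hmem.1), hU,
      concatAt_of_le _ _ hmem.2] at ht
    ext i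
    rw [Subsingleton.elim i 0]
    simpa using ht

lemma integral_supply_nonneg (hA : IsHurwitz A) (hh : IsPassiveTransfer A B C)
    (hu : IsLocallySquareIntegrable u) (hw : (predictor A B C).IsTrajectory u w)
    (hw0 : w 0 = 0) {T : ℝ} (hT : 0 ≤ T) : 0 ≤ ∫ t in (0 : ℝ)..T, u t ⬝ᵥ C *ᵥ w t := by
  obtain ⟨Uhat, -, h, -⟩ := exists_integral_supply_eq hA hu hw hw0 hT
  rw [h]
  exact integral_nonneg fun ξ => mul_nonneg (hh _) (by positivity)

lemma integral_supply_pos (hA : IsHurwitz A) (hh : IsStrictlyPassiveTransfer A B C)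
    (hu : IsLocallySquareIntegrable u) (hw : (predictor A B C).IsTrajectory u w)
    (hw0 : w 0 = 0) {T : ℝ} (hT : 0 ≤ T)
    (hne : ¬ ∀ᵐ t ∂(volume.restrict (Icc 0 T)), u t = 0) :
    0 < ∫ t in (0 : ℝ)..T, u t ⬝ᵥ C *ᵥ w t := by
  obtain ⟨Uhat, hint, h, hzero⟩ := exists_integral_supply_eq hA hu hw hw0 hT
  have hnn : ∀ ξ : ℝ, 0 ≤ (transferFunction A B C (Complex.I * ((2 * Real.pi * ξ : ℝ) : ℂ))).re *
      ‖Uhat ξ‖ ^ 2 := fun ξ => mul_nonneg (hh _).le (by positivity)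
  rw [h]
  refine (integral_nonneg hnn).lt_of_ne fun h0 => hne (hzero ?_)
  filter_upwards [(integral_eq_zero_iff_of_nonneg hnn hint).1 h0.symm] with ξ hξ
  have h1 := (mul_eq_zero.1 hξ).resolve_left (hh _).ne'
  simpa using h1

end InputOutput

/-! ### Quadratic forms from the parallelogram law -/

section Parallelogram

open Set

/-- Jordan–von Neumann: a nonnegative function on a finite-dimensional space that is homogeneous of
degree two and obeys the parallelogram law is a quadratic form, hence smooth. Both hypotheses are
stated as inequalities; replacing `x, y` by `x + y, x - y` gives their converses. -/
lemma contDiff_of_parallelogram_le {E : Type*} [NormedAddCommGroup E] [NormedSpace ℝ E]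
    [FiniteDimensional ℝ E] {V : E → ℝ} (h0 : ∀ x, 0 ≤ V x)
    (hs : ∀ (c : ℝ) (x : E), V (c • x) ≤ c ^ 2 * V x)
    (hp : ∀ x y, V (x + y) + V (x - y) ≤ 2 * V x + 2 * V y) : ContDiff ℝ 1 V := by
  have hV0 : V 0 = 0 := le_antisymm (by simpa using hs 0 0) (h0 0)
  have hneg : ∀ x, V (-x) = V x := fun x =>
    le_antisymm (by simpa using hs (-1) x) (by simpa using hs (-1) (-x))
  have htwo : ∀ x : E, V (x + x) = 4 * V x := by
    intro x
    have h1 := hs 2 x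
    have h2 := hs (1 / 2) (x + x)
    rw [← two_smul ℝ x] at h2 ⊢
    rw [smul_smul] at h2
    norm_num at h1 h2
    linarith
  have hpe : ∀ x y, V (x + y) + V (x - y) = 2 * V x + 2 * V y := by
    intro x y
    refine le_antisymm (hp x y) ?_
    have h := hp (x + y) (x - y)
    rw [show x + y + (x - y) = x + x by abel, show x + y - (x - y) = y + y by abel, htwo, htwo] at h
    linarith
  set b : E → E → ℝ := fun x y => V (x + y) - V (x - y) with hb
  have hsymm : ∀ x y, b x y = b y x := by
    intro x y
    simp only [hb]
    rw [add_comm, ← hneg (x - y), neg_sub]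
  have hadd : ∀ x y z, b (x + y) z = b x z + b y z := by
    intro x y z
    have h1 := hpe (x + y + z) (x - z)
    have h2 := hpe (x + y - z) (x + z)
    have h3 := hpe (y + z) z
    have h4 := hpe (y - z) z
    simp only [hb]
    rw [show x + y + z + (x - z) = x + x + y by abel,
      show x + y + z - (x - z) = y + z + z by abel] at h1
    rw [show x + y - z + (x + z) = x + x + y by abel,
      show x + y - z - (x + z) = y - z - z by abel] at h2
    rw [show y + z - z = y by abel] at h3
    rw [show y - z + z = y by abel] at h4
    linarith
  have hbound : ∀ x y, |b x y| ≤ 2 * V x + 2 * V y := by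
    intro x y
    have h := hpe x y
    have h1 := h0 (x + y)
    have h2 := h0 (x - y)
    rw [abs_le]
    constructor <;> simp only [hb] <;> linarith
  have hsmul : ∀ (c : ℝ) x y, b (c • x) y = c * b x y := by
    intro c x y
    -- an additive map that is bounded near `0` is linear
    let φ : ℝ →+ ℝ := AddMonoidHom.mk' (fun c => b (c • x) y) fun a a' => by
      rw [add_smul]; exact hadd _ _ _
    have hφ : Continuous φ := by
      refine φ.continuous_of_isBounded_nhds_zero (Metric.ball_mem_nhds 0 one_pos) ?_
      rw [isBounded_iff_forall_norm_le]
      refine ⟨2 * V x + 2 * V y, ?_⟩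
      rintro _ ⟨a, ha, rfl⟩
      have ha1 : a ^ 2 ≤ 1 := by
        rw [sq_le_one_iff_abs_le_one]
        simpa using (mem_ball_zero_iff.1 ha).le
      calc |b (a • x) y| ≤ 2 * V (a • x) + 2 * V y := hbound _ _
        _ ≤ 2 * V x + 2 * V y := by
          have := hs a x
          have := mul_le_mul_of_nonneg_right ha1 (h0 x)
          linarith
    have h := map_real_smul φ hφ c 1
    simpa [φ] using h
  let β : E →ₗ[ℝ] E →ₗ[ℝ] ℝ := LinearMap.mk₂ ℝ b hadd hsmul
    (fun x y z => by rw [hsymm, hadd, hsymm y, hsymm z])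
    (fun c x y => by rw [hsymm, hsmul, hsymm y]; rfl)
  have hVβ : V = fun x => (1 / 4) * β.toContinuousBilinearMap x x := by
    ext x
    simp [β, hb, hV0, htwo]
  rw [hVβ]
  fun_prop

end Parallelogram

/-! ### The required supply -/

section RequiredSupply

open Filter Topology Set

variable {m : ℕ} {A : Matrix (Fin m) (Fin m) ℝ} {B : Matrix (Fin m) (Fin 1) ℝ}
  {C : Matrix (Fin 1) (Fin m) ℝ} {u v : ℝ → Fin 1 → ℝ} {w f : ℝ → Fin m → ℝ}

lemma isTrajectory_predictor_add_smul (hw : (predictor A B C).IsTrajectory u w)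
    (hf : (predictor A B C).IsTrajectory v f) (c : ℝ) :
    (predictor A B C).IsTrajectory (fun t => u t + c • v t) (fun t => w t + c • f t) := by
  refine ControlSystem.IsTrajectory.of_integral fun t ht => ?_
  obtain ⟨h1, h2⟩ := hw.2 t ht
  obtain ⟨h3, h4⟩ := hf.2 t ht
  have hdyn : (fun τ => (predictor A B C).dyn τ (w τ + c • f τ) (u τ + c • v τ)) =
      fun τ => (predictor A B C).dyn τ (w τ) (u τ) + c • (predictor A B C).dyn τ (f τ) (v τ) := by
    ext1 τ
    simp only [predictor, Matrix.mulVec_add, Matrix.mulVec_smul, smul_add]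
    abel
  rw [hdyn]
  have h5 : IntervalIntegrable (fun τ => c • (predictor A B C).dyn τ (f τ) (v τ)) volume 0 t :=
    h3.smul c
  refine ⟨h1.add h5, ?_⟩
  rw [intervalIntegral.integral_add h1 h5, intervalIntegral.integral_smul, h2, h4, smul_add]
  abel

lemma isTrajectory_predictor_zero :
    (predictor A B C).IsTrajectory (fun _ => 0) (fun _ => 0) :=
  isTrajectory_predictor_of_hasDerivAt 0 fun t => by simpa using hasDerivAt_const t (0 : Fin m → ℝ)

lemma IsLocallySquareIntegrable.add_smul (hu : IsLocallySquareIntegrable u)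
    (hv : IsLocallySquareIntegrable v) (c : ℝ) :
    IsLocallySquareIntegrable (fun t => u t + c • v t) :=
  fun T hT => (hu T hT).add ((hv T hT).const_smul c)

variable (A B C) in
/-- The predictor can be steered from rest to `x` while absorbing the energy `c`. -/
def IsReachedWithSupply (x : Fin m → ℝ) (c : ℝ) : Prop :=
  ∃ (S : ℝ) (u : ℝ → Fin 1 → ℝ) (w : ℝ → Fin m → ℝ), 0 ≤ S ∧ IsLocallySquareIntegrable u ∧
    (predictor A B C).IsTrajectory u w ∧ w 0 = 0 ∧ w S = x ∧
    ∫ t in (0 : ℝ)..S, u t ⬝ᵥ C *ᵥ w t = c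

namespace IsReachedWithSupply

variable {x y : Fin m → ℝ} {c d : ℝ}

lemma nonneg (hA : IsHurwitz A) (hh : IsPassiveTransfer A B C)
    (h : IsReachedWithSupply A B C x c) : 0 ≤ c := by
  obtain ⟨S, u, w, hS, hu, hw, hw0, -, rfl⟩ := h
  exact integral_supply_nonneg hA hh hu hw hw0 hS

lemma zero : IsReachedWithSupply A B C 0 0 :=
  ⟨0, _, _, le_rfl, .zero, isTrajectory_predictor_zero, rfl, rfl, by simp⟩

lemma smul (h : IsReachedWithSupply A B C x c) (a : ℝ) :
    IsReachedWithSupply A B C (a • x) (a ^ 2 * c) := by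
  obtain ⟨S, u, w, hS, hu, hw, hw0, rfl, rfl⟩ := h
  refine ⟨S, _, _, hS, IsLocallySquareIntegrable.zero.add_smul hu a,
    isTrajectory_predictor_add_smul isTrajectory_predictor_zero hw a, by simp [hw0], by simp, ?_⟩
  rw [← intervalIntegral.integral_const_mul]
  refine intervalIntegral.integral_congr fun t _ => ?_
  simp only [zero_add, Matrix.mulVec_smul, smul_dotProduct, dotProduct_smul, smul_eq_mul]
  ring

lemma extend (h : IsReachedWithSupply A B C x c) (hv : IsLocallySquareIntegrable v)
    (hf : (predictor A B C).IsTrajectory v f) (hf0 : f 0 = x) {T : ℝ} (hT : 0 ≤ T) :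
    IsReachedWithSupply A B C (f T) (c + ∫ t in (0 : ℝ)..T, v t ⬝ᵥ C *ᵥ f t) := by
  obtain ⟨S, u, w, hS, hu, hw, hw0, rfl, rfl⟩ := h
  refine ⟨S + T, _, _, by positivity, hu.concatAt hv hS,
    isTrajectory_predictor_concatAt hw hf hS hf0, ?_, concatAt_add hT hf0,
    integral_supply_concatAt hu hv hw hf hS hT⟩
  rw [concatAt_of_le _ _ hS, hw0]

/-- Waiting at rest first, a state can be reached at any later time at the same cost. -/
lemma exists_of_horizon_le {S R : ℝ} (hS : 0 ≤ S) (hR : 0 ≤ R) (hu : IsLocallySquareIntegrable u)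
    (hw : (predictor A B C).IsTrajectory u w) (hw0 : w 0 = 0) :
    ∃ (u' : ℝ → Fin 1 → ℝ) (w' : ℝ → Fin m → ℝ), IsLocallySquareIntegrable u' ∧
      (predictor A B C).IsTrajectory u' w' ∧ w' 0 = 0 ∧ w' (R + S) = w S ∧
      ∫ t in (0 : ℝ)..(R + S), u' t ⬝ᵥ C *ᵥ w' t = ∫ t in (0 : ℝ)..S, u t ⬝ᵥ C *ᵥ w t := by
  refine ⟨_, _, IsLocallySquareIntegrable.zero.concatAt hu hR,
    isTrajectory_predictor_concatAt isTrajectory_predictor_zero hw hR hw0,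
    concatAt_of_le _ _ hR, concatAt_add hS hw0, ?_⟩
  rw [integral_supply_concatAt .zero hu isTrajectory_predictor_zero hw hR hS]
  simp

lemma parallelogram (hx : IsReachedWithSupply A B C x c) (hy : IsReachedWithSupply A B C y d) :
    ∃ c' d', IsReachedWithSupply A B C (x + y) c' ∧ IsReachedWithSupply A B C (x - y) d' ∧
      c' + d' = 2 * c + 2 * d := by
  obtain ⟨S, u₀, w₀, hS, hu₀, hw₀, hw₀0, rfl, rfl⟩ := hx
  obtain ⟨R, v₀, f₀, hR, hv₀, hf₀, hf₀0, rfl, rfl⟩ := hy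
  -- a common horizon for both
  obtain ⟨u, w, hu, hw, hw0, hwe, hwi⟩ := exists_of_horizon_le (C := C) hS hR hu₀ hw₀ hw₀0
  obtain ⟨v, f, hv, hf, hf0, hfe, hfi⟩ := exists_of_horizon_le (C := C) hR hS hv₀ hf₀ hf₀0
  rw [add_comm S R] at hfe hfi
  have hRS : 0 ≤ R + S := by positivity
  have hp := isTrajectory_predictor_add_smul hw hf 1
  have hn := isTrajectory_predictor_add_smul hw hf (-1)
  refine ⟨_, _,
    ⟨R + S, _, _, hRS, hu.add_smul hv 1, hp, by simp [hw0, hf0], by simp [hwe, hfe], rfl⟩,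
    ⟨R + S, _, _, hRS, hu.add_smul hv (-1), hn, by simp [hw0, hf0],
      by simp [hwe, hfe, sub_eq_add_neg], rfl⟩, ?_⟩
  rw [← hwi, ← hfi, ← intervalIntegral.integral_add
      (intervalIntegrable_supply (hu.add_smul hv 1) hp hRS)
      (intervalIntegrable_supply (hu.add_smul hv (-1)) hn hRS),
    ← intervalIntegral.integral_const_mul, ← intervalIntegral.integral_const_mul,
    ← intervalIntegral.integral_add ((intervalIntegrable_supply hu hw hRS).const_mul 2)
      ((intervalIntegrable_supply hv hf hRS).const_mul 2)]
  refine intervalIntegral.integral_congr fun t _ => ?_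
  simp only [Matrix.mulVec_add, Matrix.mulVec_smul, add_dotProduct, dotProduct_add,
    smul_dotProduct, dotProduct_smul, smul_eq_mul]
  ring

end IsReachedWithSupply

/-- A stable predictor has a classical solution for every initial state and constant input. -/
lemma IsHurwitz.exists_solution_const (hA : IsHurwitz A) (x : Fin m → ℝ) (c : Fin 1 → ℝ) :
    ∃ f : ℝ → Fin m → ℝ, f 0 = x ∧ ∀ t, HasDerivAt f (A *ᵥ f t + B *ᵥ c) t := by
  obtain ⟨g, hg0, hg, -⟩ := hA.exists_decaying (x + (A⁻¹ * B) *ᵥ c)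
  refine ⟨fun t => g t - (A⁻¹ * B) *ᵥ c, by simp [hg0], fun t => ?_⟩
  have h : A *ᵥ (g t - (A⁻¹ * B) *ᵥ c) + B *ᵥ c = A *ᵥ g t := by
    rw [Matrix.mulVec_sub, Matrix.mulVec_mulVec, ← Matrix.mul_assoc,
      Matrix.mul_nonsing_inv _ hA.isUnit_det, Matrix.one_mul, sub_add_cancel]
  rw [h]
  exact (hg t).sub_const _

/-- Under controllability every state is reachable: the reachable states form a subspace, and the
velocities of motions within it show that it contains the column `B` and is invariant under `A`. -/
lemma IsControllable.exists_isReachedWithSupply (hA : IsHurwitz A) (hc : IsControllable A B)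
    (x : Fin m → ℝ) : ∃ c, IsReachedWithSupply A B C x c := by
  let R : Submodule ℝ (Fin m → ℝ) :=
    { carrier := {x | ∃ c, IsReachedWithSupply A B C x c}
      zero_mem' := ⟨0, .zero⟩
      add_mem' := by
        rintro a b ⟨c, hc⟩ ⟨d, hd⟩
        obtain ⟨c', -, h, -⟩ := hc.parallelogram hd
        exact ⟨c', h⟩
      smul_mem' := by
        rintro a x ⟨c, hc⟩
        exact ⟨_, hc.smul a⟩ }
  -- the subspace is closed, so it contains the velocity at time `0` of any motion inside it
  have hvel : ∀ y ∈ R, ∀ c : Fin 1 → ℝ, A *ᵥ y + B *ᵥ c ∈ R := by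
    rintro y ⟨e, he⟩ c
    obtain ⟨f, hf0, hf⟩ := hA.exists_solution_const (B := B) y c
    have hmem : ∀ t, 0 ≤ t → f t ∈ R := fun t ht =>
      ⟨_, he.extend (fun T _ => memLp_const c) (isTrajectory_predictor_of_hasDerivAt c hf) hf0 ht⟩
    have hd := hf 0
    rw [hf0, hasDerivAt_iff_tendsto_slope] at hd
    refine (Submodule.closed_of_finiteDimensional R).mem_of_tendsto
      (hd.mono_left (nhdsWithin_mono 0 (show Ioi (0 : ℝ) ⊆ {0}ᶜ from fun t ht => ne_of_gt ht))) ?_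
    filter_upwards [self_mem_nhdsWithin] with t ht
    rw [slope_def_module]
    exact R.smul_mem _ (R.sub_mem (hmem t (le_of_lt ht)) (hmem 0 le_rfl))
  have hcol : ∀ k : ℕ, (A ^ k * B).col 0 ∈ R := by
    intro k
    induction k with
    | zero =>
      have := hvel 0 R.zero_mem 1
      convert! this using 1
      ext i
      simp [Matrix.mulVec, dotProduct]
    | succ k ih =>
      have := hvel _ ih 0
      convert! this using 1
      rw [pow_succ', Matrix.mul_assoc]
      ext i
      simp [Matrix.mulVec, dotProduct, Matrix.mul_apply (M := A)]
  have htop : (⊤ : Submodule ℝ (Fin m → ℝ)) ≤ R := by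
    rw [← hc]
    exact Submodule.span_le.2 (by rintro _ ⟨k, rfl⟩; exact hcol k)
  exact htop (Submodule.mem_top (x := x))

/-- For a controllable realization the required supply, the least energy needed to reach a state
from rest, is a quadratic storage function. -/
lemma isPassive_predictor_of_isControllable (hA : IsHurwitz A) (hh : IsPassiveTransfer A B C)
    (hc : IsControllable A B) : (predictor A B C).IsPassive := by
  let V : (Fin m → ℝ) → ℝ := fun x => sInf {c | IsReachedWithSupply A B C x c}
  have hne : ∀ x, {c | IsReachedWithSupply A B C x c}.Nonempty :=
    fun x => hc.exists_isReachedWithSupply hA x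
  have hbdd : ∀ x, BddBelow {c | IsReachedWithSupply A B C x c} :=
    fun x => ⟨0, fun c h => IsReachedWithSupply.nonneg hA hh h⟩
  have hle : ∀ {x c}, IsReachedWithSupply A B C x c → V x ≤ c := fun h => csInf_le (hbdd _) h
  have happrox : ∀ x, ∀ ε > 0, ∃ c, IsReachedWithSupply A B C x c ∧ c < V x + ε := fun x ε hε =>
    exists_lt_of_csInf_lt (hne x) (lt_add_of_pos_right _ hε)
  refine ⟨V, contDiff_of_parallelogram_le ?_ ?_ ?_, ?_, ?_⟩
  · exact fun x => le_csInf (hne x) fun c h => h.nonneg hA hh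
  · intro a x
    refine le_of_forall_pos_le_add fun ε hε => ?_
    obtain ⟨c, hc, hlt⟩ := happrox x (ε / (a ^ 2 + 1)) (by positivity)
    have h1 := hle (hc.smul a)
    have h2 : a ^ 2 * (ε / (a ^ 2 + 1)) ≤ ε := by
      rw [mul_div_assoc', div_le_iff₀ (by positivity)]
      nlinarith
    have h3 := mul_le_mul_of_nonneg_left hlt.le (sq_nonneg a)
    rw [mul_add] at h3
    linarith
  · intro x y
    refine le_of_forall_pos_le_add fun ε hε => ?_
    obtain ⟨c, hc, hclt⟩ := happrox x (ε / 4) (by positivity)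
    obtain ⟨d, hd, hdlt⟩ := happrox y (ε / 4) (by positivity)
    obtain ⟨c', d', hc', hd', heq⟩ := hc.parallelogram hd
    have h1 := hle hc'
    have h2 := hle hd'
    linarith
  · exact fun x => le_csInf (hne x) fun c h => h.nonneg hA hh
  · intro u w hu hw T hT
    refine le_of_forall_pos_le_add fun ε hε => ?_
    obtain ⟨c, hc, hclt⟩ := happrox (w 0) ε hε
    have h1 := hle (hc.extend hu hw rfl hT)
    change V (w T) - V (w 0) ≤ (∫ t in (0 : ℝ)..T, u t ⬝ᵥ C *ᵥ w t) + ε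
    linarith

end RequiredSupply

/-! ### Linearization of softmax at uniform scores -/

section Softmax

variable {n : ℕ}

variable (n) in
/-- The orthogonal projection `v ↦ v - (mean of v) 𝟏` along `𝟏`. For `n = 0` it is the only map
there is. -/
def centering : (Fin n → ℝ) →L[ℝ] (Fin n → ℝ) :=
  ContinuousLinearMap.pi fun i =>
    ContinuousLinearMap.proj i - (n : ℝ)⁻¹ • ∑ j, ContinuousLinearMap.proj (R := ℝ) j

lemma centering_apply (v : Fin n → ℝ) (i : Fin n) :
    centering n v i = v i - (n : ℝ)⁻¹ * ∑ j, v j := by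
  simp [centering]

lemma sum_centering (v : Fin n → ℝ) : ∑ i, centering n v i = 0 := by
  rcases n.eq_zero_or_pos with rfl | hn
  · simp
  · have : (n : ℝ) ≠ 0 := by positivity
    simp [centering_apply, Finset.sum_sub_distrib, this]

lemma one_dotProduct_centering (v : Fin n → ℝ) : (1 : Fin n → ℝ) ⬝ᵥ centering n v = 0 := by
  rw [one_dotProduct, sum_centering]

lemma dotProduct_centering (u v : Fin n → ℝ) :
    u ⬝ᵥ centering n v = ∑ i, centering n u i * centering n v i := by
  simp_rw [centering_apply u, sub_mul, Finset.sum_sub_distrib, ← Finset.mul_sum, sum_centering]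
  simp [dotProduct]

lemma softmax_smul_one (c : ℝ) : softmax (c • (1 : Fin n → ℝ)) = fun _ => (n : ℝ)⁻¹ := by
  ext i
  have : Real.exp c ≠ 0 := (Real.exp_pos c).ne'
  simp only [softmax, Pi.smul_apply, Pi.one_apply, smul_eq_mul, mul_one, Finset.sum_const,
    Finset.card_univ, Fintype.card_fin, nsmul_eq_mul]
  rw [div_mul_eq_div_div_swap, div_self this, one_div]

lemma hasFDerivAt_softmax_smul_one (c : ℝ) :
    HasFDerivAt softmax ((n : ℝ)⁻¹ • centering n) (c • (1 : Fin n → ℝ)) := by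
  rw [hasFDerivAt_pi']
  intro i
  have hn : (n : ℝ) ≠ 0 := by exact_mod_cast (Fin.pos i).ne'
  have hexp : Real.exp c ≠ 0 := (Real.exp_pos c).ne'
  have he : ∀ j : Fin n, HasFDerivAt (fun v : Fin n → ℝ => Real.exp (v j))
      (Real.exp c • ContinuousLinearMap.proj (R := ℝ) j) (c • (1 : Fin n → ℝ)) := fun j => by
    simpa using (hasFDerivAt_apply (𝕜 := ℝ) j (c • (1 : Fin n → ℝ))).exp
  have hsum : HasFDerivAt (fun v : Fin n → ℝ => ∑ j, Real.exp (v j))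
      (∑ j, Real.exp c • ContinuousLinearMap.proj (R := ℝ) j) (c • (1 : Fin n → ℝ)) :=
    HasFDerivAt.fun_sum fun j _ => he j
  have hne : ∑ j, Real.exp ((c • (1 : Fin n → ℝ)) j) ≠ 0 := by simp [hn, hexp]
  convert! (he i).mul (HasDerivAt.comp_hasFDerivAt
    (f := fun v : Fin n → ℝ => ∑ j, Real.exp (v j)) (c • 1) (hasDerivAt_inv hne) hsum) using 1
  ext v
  simp [centering_apply, ← Finset.mul_sum]
  field_simp
  ring

end Softmax

/-! ### The linearized dynamics -/

section Linearization

open Set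

variable {m n : ℕ} {A : Matrix (Fin m) (Fin m) ℝ} {B : Matrix (Fin m) (Fin 1) ℝ}
  {C : Matrix (Fin 1) (Fin m) ℝ}

lemma kronA_mulVec_apply (s : Fin m × Fin n → ℝ) (k : Fin m) (i : Fin n) :
    (kronA A n *ᵥ s) (k, i) = ∑ l, A k l * s (l, i) := by
  simp [kronA, Matrix.mulVec, dotProduct, Fintype.sum_prod_type, Matrix.one_apply]

lemma kronB_mulVec_apply (p : Fin n → ℝ) (k : Fin m) (i : Fin n) :
    (kronB B n *ᵥ p) (k, i) = B k 0 * p i := by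
  simp [kronB, Matrix.mulVec, dotProduct, Matrix.one_apply]

lemma kronC_mulVec_apply (s : Fin m × Fin n → ℝ) (i : Fin n) :
    (kronC C n *ᵥ s) i = ∑ l, C 0 l * s (l, i) := by
  simp [kronC, Matrix.mulVec, dotProduct, Fintype.sum_prod_type, Matrix.one_apply]

variable (C n) in
/-- `C ⊗ Iₙ` as a continuous linear map. -/
def kronCL : (Fin m × Fin n → ℝ) →L[ℝ] (Fin n → ℝ) :=
  (Matrix.toLin' (kronC C n)).toContinuousLinearMap

@[simp]
lemma kronCL_apply (s : Fin m × Fin n → ℝ) : kronCL n C s = kronC C n *ᵥ s := by simp [kronCL]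

variable (A B C n) in
lemma uniformState_score (t : ℝ) :
    (uniformState A B n t).1 + kronC C n *ᵥ (uniformState A B n t).2 =
      (t + ∑ l, C 0 l * ((-A)⁻¹ * B) l 0) • (1 : Fin n → ℝ) := by
  ext i
  simp [uniformState, uniformScore, kronC_mulVec_apply]

lemma linearize_predictiveRD_dyn (xs : ℝ → (Fin n → ℝ) × (Fin m × Fin n → ℝ)) (us : ℝ → Fin n → ℝ)
    (t : ℝ) (ξ : (Fin n → ℝ) × (Fin m × Fin n → ℝ)) (ν : Fin n → ℝ) :
    ((predictiveRD A B C n).linearize xs us).dyn t ξ ν =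
      (ν, kronA A n *ᵥ ξ.2 + kronB B n *ᵥ ν) := by
  let L : ((Fin n → ℝ) × (Fin m × Fin n → ℝ)) × (Fin n → ℝ) →L[ℝ]
      (Fin n → ℝ) × (Fin m × Fin n → ℝ) :=
    (ContinuousLinearMap.snd ℝ _ _).prod
      ((Matrix.toLin' (kronA A n)).toContinuousLinearMap.comp
          ((ContinuousLinearMap.snd ℝ _ _).comp (ContinuousLinearMap.fst ℝ _ _)) +
        (Matrix.toLin' (kronB B n)).toContinuousLinearMap.comp (ContinuousLinearMap.snd ℝ _ _))
  have hL : (fun q : ((Fin n → ℝ) × (Fin m × Fin n → ℝ)) × (Fin n → ℝ) =>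
      (predictiveRD A B C n).dyn t q.1 q.2) = L := by
    ext1 q
    simp [L, predictiveRD]
  simp only [ControlSystem.linearize]
  rw [hL, L.fderiv]
  simp [L]

lemma linearize_standardRD_dyn (xs us : ℝ → Fin n → ℝ) (t : ℝ) (ζ ν : Fin n → ℝ) :
    ((standardRD n).linearize xs us).dyn t ζ ν = ν := by
  simp only [ControlSystem.linearize, standardRD]
  rw [(hasFDerivAt_snd (𝕜 := ℝ)).fderiv]
  rfl

lemma hasFDerivAt_predictiveRD_out (t : ℝ) (us : Fin n → ℝ) :
    HasFDerivAt (fun q : ((Fin n → ℝ) × (Fin m × Fin n → ℝ)) × (Fin n → ℝ) =>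
        (predictiveRD A B C n).out t q.1 q.2)
      (((n : ℝ)⁻¹ • centering n).comp (((ContinuousLinearMap.fst ℝ _ _) +
        (kronCL n C).comp (ContinuousLinearMap.snd ℝ _ _)).comp
          (ContinuousLinearMap.fst ℝ ((Fin n → ℝ) × (Fin m × Fin n → ℝ)) (Fin n → ℝ))))
      (uniformState A B n t, us) := by
  have h := hasFDerivAt_softmax_smul_one (n := n) (t + ∑ l, C 0 l * ((-A)⁻¹ * B) l 0)
  rw [← uniformState_score] at h
  let L : ((Fin n → ℝ) × (Fin m × Fin n → ℝ)) × (Fin n → ℝ) →L[ℝ] (Fin n → ℝ) :=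
    ((ContinuousLinearMap.fst ℝ _ _) +
        (kronCL n C).comp (ContinuousLinearMap.snd ℝ _ _)).comp (ContinuousLinearMap.fst ℝ _ _)
  have hL : ∀ q, L q = q.1.1 + kronC C n *ᵥ q.1.2 := fun q => by simp [L]
  rw [← hL (uniformState A B n t, us)] at h
  exact h.comp (uniformState A B n t, us) L.hasFDerivAt

lemma hasFDerivAt_standardRD_out (t : ℝ) (us : Fin n → ℝ) :
    HasFDerivAt (fun q : (Fin n → ℝ) × (Fin n → ℝ) => (standardRD n).out t q.1 q.2)
      (((n : ℝ)⁻¹ • centering n).comp (ContinuousLinearMap.fst ℝ _ _)) (uniformScore n t, us) :=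
  HasFDerivAt.comp (f := Prod.fst) (uniformScore n t, us)
    (hasFDerivAt_softmax_smul_one (n := n) t) hasFDerivAt_fst

lemma linearize_predictiveRD_out (t : ℝ) (ξ : (Fin n → ℝ) × (Fin m × Fin n → ℝ)) (ν : Fin n → ℝ) :
    ((predictiveRD A B C n).linearize (uniformState A B n) (uniformPayoff n)).out t ξ ν =
      (n : ℝ)⁻¹ • centering n (ξ.1 + kronC C n *ᵥ ξ.2) := by
  simp only [ControlSystem.linearize]
  rw [(hasFDerivAt_predictiveRD_out t _).fderiv]
  simp

lemma linearize_standardRD_out (t : ℝ) (ζ ν : Fin n → ℝ) :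
    ((standardRD n).linearize (uniformScore n) (uniformPayoff n)).out t ζ ν =
      (n : ℝ)⁻¹ • centering n ζ := by
  simp only [ControlSystem.linearize]
  rw [(hasFDerivAt_standardRD_out t _).fderiv]
  simp

lemma linearize_comparisonSystem_out (t : ℝ) (ξ : (Fin n → ℝ) × (Fin m × Fin n → ℝ))
    (ν : Fin n → ℝ) :
    ((comparisonSystem A B C n).linearize (uniformState A B n) (uniformPayoff n)).out t ξ ν =
      (n : ℝ)⁻¹ • centering n (kronC C n *ᵥ ξ.2) := by
  have h1 := hasFDerivAt_predictiveRD_out (A := A) (B := B) (C := C) t (uniformPayoff n t)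
  have h2 : HasFDerivAt (fun q : ((Fin n → ℝ) × (Fin m × Fin n → ℝ)) × (Fin n → ℝ) =>
      (standardRD n).out t q.1.1 q.2)
      (((n : ℝ)⁻¹ • centering n).comp ((ContinuousLinearMap.fst ℝ _ _).comp
        (ContinuousLinearMap.fst ℝ ((Fin n → ℝ) × (Fin m × Fin n → ℝ)) (Fin n → ℝ))))
      (uniformState A B n t, uniformPayoff n t) :=
    HasFDerivAt.comp (f := fun q : ((Fin n → ℝ) × (Fin m × Fin n → ℝ)) × (Fin n → ℝ) => q.1.1)
      (uniformState A B n t, uniformPayoff n t)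
      (hasFDerivAt_softmax_smul_one (n := n) t) (hasFDerivAt_fst.comp _ hasFDerivAt_fst)
  simp only [ControlSystem.linearize, comparisonSystem]
  rw [(h1.fun_sub h2).fderiv]
  simp

variable (m n) in
/-- The `i`-th predictor state of the deviations, after projecting along `𝟏`. -/
def centeredState (i : Fin n) : (Fin n → ℝ) × (Fin m × Fin n → ℝ) →L[ℝ] (Fin m → ℝ) :=
  ContinuousLinearMap.pi fun k => (ContinuousLinearMap.proj i).comp ((centering n).comp
    (ContinuousLinearMap.pi fun j => (ContinuousLinearMap.proj (R := ℝ) (k, j)).comp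
      (ContinuousLinearMap.snd ℝ _ _)))

lemma centeredState_apply (i : Fin n) (ξ : (Fin n → ℝ) × (Fin m × Fin n → ℝ)) (k : Fin m) :
    centeredState m n i ξ k = ξ.2 (k, i) - (n : ℝ)⁻¹ * ∑ j, ξ.2 (k, j) := by
  simp [centeredState, centering_apply]

variable (n) in
/-- The `i`-th coordinate of the input deviation, after projecting along `𝟏`. -/
def centeredInput (i : Fin n) : (Fin n → ℝ) →L[ℝ] (Fin 1 → ℝ) :=
  ContinuousLinearMap.pi fun _ => (ContinuousLinearMap.proj i).comp (centering n)

@[simp]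
lemma centeredInput_apply (i : Fin n) (ν : Fin n → ℝ) (k : Fin 1) :
    centeredInput n i ν k = centering n ν i := rfl

lemma mulVec_centeredState (i : Fin n) (ξ : (Fin n → ℝ) × (Fin m × Fin n → ℝ)) :
    (C *ᵥ centeredState m n i ξ) 0 = centering n (kronC C n *ᵥ ξ.2) i := by
  simp only [Matrix.mulVec, dotProduct, centeredState_apply, centering_apply]
  have h := fun i => kronC_mulVec_apply (C := C) ξ.2 i
  simp only [Matrix.mulVec, dotProduct] at h
  simp only [h, mul_sub, Finset.sum_sub_distrib]
  rw [Finset.sum_comm, Finset.mul_sum]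
  congr 1
  refine Finset.sum_congr rfl fun l _ => ?_
  rw [← Finset.mul_sum]
  ring

/-- The projection commutes with `A ⊗ I` and `B ⊗ I`, so each centered coordinate of the linearized
system follows the scalar predictor. -/
lemma isTrajectory_centeredState {Δp : ℝ → Fin n → ℝ}
    {ξ : ℝ → (Fin n → ℝ) × (Fin m × Fin n → ℝ)}
    {xs : ℝ → (Fin n → ℝ) × (Fin m × Fin n → ℝ)} {us : ℝ → Fin n → ℝ}
    (hξ : ((predictiveRD A B C n).linearize xs us).IsTrajectory Δp ξ) (i : Fin n) :
    (predictor A B C).IsTrajectory (fun t => centeredInput n i (Δp t))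
      (fun t => centeredState m n i (ξ t)) := by
  refine hξ.map _ fun t => ?_
  rw [linearize_predictiveRD_dyn]
  ext k
  simp only [centeredState_apply, predictor, Pi.add_apply, kronA_mulVec_apply, kronB_mulVec_apply]
  simp only [Matrix.mulVec, dotProduct, centeredState_apply, Fin.sum_univ_one, Fin.isValue,
    centeredInput_apply, centering_apply, mul_sub, Finset.sum_sub_distrib, Finset.sum_add_distrib]
  rw [Finset.sum_comm (s := Finset.univ (α := Fin n)), mul_add, Finset.mul_sum (a := (n : ℝ)⁻¹),
    ← Finset.mul_sum (a := B k 0)]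
  have h : ∀ l, (n : ℝ)⁻¹ * ∑ j, A k l * (ξ t).2 (l, j) =
      A k l * ((n : ℝ)⁻¹ * ∑ j, (ξ t).2 (l, j)) := fun l => by rw [← Finset.mul_sum]; ring
  simp only [h]
  ring

lemma dotProduct_centering_kronC (ν : Fin n → ℝ) (ξ : (Fin n → ℝ) × (Fin m × Fin n → ℝ)) :
    ν ⬝ᵥ ((n : ℝ)⁻¹ • centering n (kronC C n *ᵥ ξ.2)) =
      (n : ℝ)⁻¹ * ∑ i, centeredInput n i ν ⬝ᵥ C *ᵥ centeredState m n i ξ := by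
  rw [dotProduct_smul, dotProduct_centering, smul_eq_mul]
  congr 1
  refine Finset.sum_congr rfl fun i _ => ?_
  rw [← mulVec_centeredState]
  simp [dotProduct]

lemma integral_linearized_supply {Δp : ℝ → Fin n → ℝ}
    {ξ : ℝ → (Fin n → ℝ) × (Fin m × Fin n → ℝ)}
    {xs : ℝ → (Fin n → ℝ) × (Fin m × Fin n → ℝ)} {us : ℝ → Fin n → ℝ}
    (hΔp : IsLocallySquareIntegrable Δp)
    (hξ : ((predictiveRD A B C n).linearize xs us).IsTrajectory Δp ξ) {T : ℝ} (hT : 0 ≤ T) :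
    ∫ t in (0 : ℝ)..T, Δp t ⬝ᵥ ((n : ℝ)⁻¹ • centering n (kronC C n *ᵥ (ξ t).2)) =
      (n : ℝ)⁻¹ * ∑ i, ∫ t in (0 : ℝ)..T,
        centeredInput n i (Δp t) ⬝ᵥ C *ᵥ centeredState m n i (ξ t) := by
  simp_rw [dotProduct_centering_kronC]
  rw [intervalIntegral.integral_const_mul, intervalIntegral.integral_finsetSum]
  exact fun i _ => intervalIntegrable_supply (hΔp.map _) (isTrajectory_centeredState hξ i) hT

end Linearization

/-! ### Passivity and dominance -/

section Dominance

open Set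

variable {m n : ℕ} {A : Matrix (Fin m) (Fin m) ℝ} {B : Matrix (Fin m) (Fin 1) ℝ}
  {C : Matrix (Fin 1) (Fin m) ℝ}

lemma isTrajectory_uniform (hA : IsHurwitz A) :
    (comparisonSystem A B C n).IsTrajectory (uniformPayoff n) (uniformState A B n) := by
  have hdyn : ∀ t : ℝ, (comparisonSystem A B C n).dyn t (uniformState A B n t)
      (uniformPayoff n t) = ((1 : Fin n → ℝ), 0) := by
    intro t
    have hdet : IsUnit (-A).det := (Matrix.isUnit_iff_isUnit_det _).1
      ((Matrix.isUnit_iff_isUnit_det _).2 hA.isUnit_det).neg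
    have h : A * ((-A)⁻¹ * B) = -B := by
      rw [← neg_inj, ← Matrix.neg_mul, ← Matrix.mul_assoc, Matrix.mul_nonsing_inv _ hdet,
        Matrix.one_mul, neg_neg]
    refine Prod.ext rfl ?_
    ext ⟨k, i⟩
    have hk := congrFun (congrFun h k) 0
    rw [Matrix.mul_apply] at hk
    simp [comparisonSystem, predictiveRD, kronA_mulVec_apply, kronB_mulVec_apply, uniformState,
      uniformPayoff, hk]
  refine ControlSystem.IsTrajectory.of_integral fun t _ => ?_
  simp only [hdyn]
  refine ⟨intervalIntegrable_const, ?_⟩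
  rw [intervalIntegral.integral_const]
  refine Prod.ext ?_ ?_
  · simp [uniformState, uniformScore]
  · simp [uniformState]

lemma comparisonSystem_out_uniform (t : ℝ) :
    (comparisonSystem A B C n).out t (uniformState A B n t) (uniformPayoff n t) = 0 := by
  simp only [comparisonSystem, predictiveRD, standardRD, uniformState_score, softmax_smul_one]
  rw [show (uniformState A B n t).1 = t • 1 from rfl, softmax_smul_one, sub_self]

lemma centeredState_zero (i : Fin n) {ξ : ℝ → (Fin n → ℝ) × (Fin m × Fin n → ℝ)} (h : ξ 0 = 0) :
    centeredState m n i (ξ 0) = 0 := by rw [h, map_zero]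

lemma isIOPassive_linearize (hA : IsHurwitz A) (hh : IsPassiveTransfer A B C) :
    ((comparisonSystem A B C n).linearize (uniformState A B n) (uniformPayoff n)).IsIOPassive := by
  refine ⟨0, fun u ξ hu hξ hξ0 T hT => ?_⟩
  simp_rw [linearize_comparisonSystem_out]
  rw [integral_linearized_supply hu hξ hT]
  exact mul_nonneg (by positivity) (Finset.sum_nonneg fun i _ =>
    integral_supply_nonneg hA hh (hu.map _) (isTrajectory_centeredState hξ i)
      (centeredState_zero i hξ0) hT)

/-- A storage function of the predictor, summed over the centered coordinates, is one of the
linearized comparison system. -/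
lemma isPassive_linearize (h : (predictor A B C).IsPassive) :
    ((comparisonSystem A B C n).linearize (uniformState A B n) (uniformPayoff n)).IsPassive := by
  obtain ⟨V, hV, hV0, hdiss⟩ := h
  refine ⟨fun ξ => (n : ℝ)⁻¹ * ∑ i, V (centeredState m n i ξ), ?_, fun ξ => ?_, ?_⟩
  · exact contDiff_const.mul (ContDiff.sum fun i _ => hV.comp (centeredState m n i).contDiff)
  · exact mul_nonneg (by positivity) (Finset.sum_nonneg fun i _ => hV0 _)
  · intro u ξ hu hξ T hT
    simp_rw [linearize_comparisonSystem_out]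
    rw [integral_linearized_supply hu hξ hT, ← mul_sub, ← Finset.sum_sub_distrib]
    exact mul_le_mul_of_nonneg_left (Finset.sum_le_sum fun i _ =>
      hdiss _ _ (hu.map _) (isTrajectory_centeredState hξ i) T hT) (by positivity)

/-- To first order, the payoff that predictive replicator dynamics gains over standard replicator
dynamics is the energy absorbed by the linearized comparison system: the uniform part of the payoff
earns nothing on centered outputs. -/
lemma integral_payoff_predictive_eq {Δp : ℝ → Fin n → ℝ}
    {ξ : ℝ → (Fin n → ℝ) × (Fin m × Fin n → ℝ)} {ζ : ℝ → Fin n → ℝ}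
    (hΔp : IsLocallySquareIntegrable Δp)
    (hξ : ((predictiveRD A B C n).linearize (uniformState A B n) (uniformPayoff n)).IsTrajectory
      Δp ξ) (hξ0 : ξ 0 = 0)
    (hζ : ((standardRD n).linearize (uniformScore n) (uniformPayoff n)).IsTrajectory Δp ζ)
    (hζ0 : ζ 0 = 0) {T : ℝ} (hT : 0 ≤ T) :
    ∫ t in (0 : ℝ)..T, (uniformPayoff n + Δp) t ⬝ᵥ
        (predictiveRD A B C n).firstOrderOutput (uniformState A B n) (uniformPayoff n) ξ Δp t =
      (∫ t in (0 : ℝ)..T, (uniformPayoff n + Δp) t ⬝ᵥ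
        (standardRD n).firstOrderOutput (uniformScore n) (uniformPayoff n) ζ Δp t) +
      (n : ℝ)⁻¹ * ∑ i, ∫ t in (0 : ℝ)..T,
        centeredInput n i (Δp t) ⬝ᵥ C *ᵥ centeredState m n i (ξ t) := by
  -- both score deviations are the integral of the payoff deviation
  have hscore : ∀ t, 0 ≤ t → (ξ t).1 = ζ t := by
    intro t ht
    have hfst : ((standardRD n).linearize (uniformScore n) (uniformPayoff n)).IsTrajectory Δp
        (fun t => ContinuousLinearMap.fst ℝ (Fin n → ℝ) (Fin m × Fin n → ℝ) (ξ t)) :=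
      hξ.map _ fun t => by rw [linearize_predictiveRD_dyn, linearize_standardRD_dyn]; rfl
    have h1 := (hfst.2 t ht).2
    have h2 := (hζ.2 t ht).2
    simp only [linearize_standardRD_dyn, ContinuousLinearMap.coe_fst', hξ0, Prod.fst_zero] at h1
    simp only [linearize_standardRD_dyn, hζ0] at h2
    rw [h1, h2]
  have hstd : ∀ t, (standardRD n).firstOrderOutput (uniformScore n) (uniformPayoff n) ζ Δp t =
      (fun _ => (n : ℝ)⁻¹) + (n : ℝ)⁻¹ • centering n (ζ t) := by
    intro t
    rw [ControlSystem.firstOrderOutput, linearize_standardRD_out]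
    congr 1
    exact softmax_smul_one t
  have hpred : ∀ t, 0 ≤ t →
      (predictiveRD A B C n).firstOrderOutput (uniformState A B n) (uniformPayoff n) ξ Δp t =
      (standardRD n).firstOrderOutput (uniformScore n) (uniformPayoff n) ζ Δp t +
        (n : ℝ)⁻¹ • centering n (kronC C n *ᵥ (ξ t).2) := by
    intro t ht
    rw [hstd, ControlSystem.firstOrderOutput, linearize_predictiveRD_out, hscore t ht, map_add,
      smul_add, add_assoc]
    congr 1
    simp only [predictiveRD, uniformState_score, softmax_smul_one]
  have hp : IsLocallySquareIntegrable (uniformPayoff n + Δp) :=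
    IsLocallySquareIntegrable.add (fun T hT => memLp_const 1) hΔp
  have hint1 : IntervalIntegrable (fun t => (uniformPayoff n + Δp) t ⬝ᵥ
      (standardRD n).firstOrderOutput (uniformScore n) (uniformPayoff n) ζ Δp t) volume 0 T := by
    refine hp.intervalIntegrable_dotProduct ?_ hT
    have hc : ContinuousOn (fun t => (n : ℝ)⁻¹ • centering n (ζ t)) (Ici 0) :=
      ((n : ℝ)⁻¹ • centering n).continuous.comp_continuousOn hζ.1
    exact (continuousOn_const (c := fun _ : Fin n => (n : ℝ)⁻¹)).add hc |>.congr fun t _ => hstd t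
  have hint2 : IntervalIntegrable (fun t => Δp t ⬝ᵥ
      ((n : ℝ)⁻¹ • centering n (kronC C n *ᵥ (ξ t).2))) volume 0 T := by
    refine hΔp.intervalIntegrable_dotProduct ?_ hT
    have hc : ContinuousOn (fun t => (n : ℝ)⁻¹ • centering n (kronCL n C (ξ t).2)) (Ici 0) :=
      ((n : ℝ)⁻¹ • centering n).continuous.comp_continuousOn
        ((kronCL n C).continuous.comp_continuousOn (continuous_snd.comp_continuousOn hξ.1))
    simp_rw [← kronCL_apply]
    exact hc
  rw [← integral_linearized_supply hΔp hξ hT, ← intervalIntegral.integral_add hint1 hint2]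
  refine intervalIntegral.integral_congr fun t ht => ?_
  rw [uIcc_of_le hT] at ht
  simp only [hpred t ht.1, dotProduct_add]
  congr 1
  rw [Pi.add_apply, add_dotProduct, show uniformPayoff n t = 1 from rfl,
    dotProduct_smul (n : ℝ)⁻¹ (1 : Fin n → ℝ),
    one_dotProduct_centering, smul_zero, zero_add]

lemma ae_eq_const_of_centeredInput_ae_eq_zero {Δp : ℝ → Fin n → ℝ} {μ : Measure ℝ}
    (h : ∀ i, ∀ᵐ t ∂μ, centeredInput n i (Δp t) = 0) : ∀ᵐ t ∂μ, ∃ c : ℝ, Δp t = c • 1 := by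
  filter_upwards [ae_all_iff.2 h] with t ht
  refine ⟨(n : ℝ)⁻¹ * ∑ j, Δp t j, ?_⟩
  ext i
  have := congrFun (ht i) 0
  rw [centeredInput_apply, centering_apply, Pi.zero_apply, sub_eq_zero] at this
  simpa using this

end Dominance

end

theorem mainTheorem5 (n m : ℕ) (A : Matrix (Fin m) (Fin m) ℝ)
    (B : Matrix (Fin m) (Fin 1) ℝ) (C : Matrix (Fin 1) (Fin m) ℝ)
    (hstable : IsHurwitz A) (hpassive : IsPassiveTransfer A B C) :
    -- the uniform trajectory is a trajectory of the comparison system, with zero output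
    ((comparisonSystem A B C n).IsTrajectory (uniformPayoff n) (uniformState A B n) ∧
      ∀ t : ℝ, (comparisonSystem A B C n).out t (uniformState A B n t) (uniformPayoff n t) = 0) ∧
    -- passivity of the linearized comparison system, as an input-output operator
    ((comparisonSystem A B C n).linearize (uniformState A B n) (uniformPayoff n)).IsIOPassive ∧
    -- passivity of the linearized comparison system, with a storage function
    ((IsControllable A B ∨ (predictor A B C).IsPassive) →
      ((comparisonSystem A B C n).linearize (uniformState A B n) (uniformPayoff n)).IsPassive) ∧
    -- local uniform dominance, and its strict form
    (∀ (Δp : ℝ → Fin n → ℝ) (ξ : ℝ → (Fin n → ℝ) × (Fin m × Fin n → ℝ)) (ζ : ℝ → Fin n → ℝ),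
      IsLocallySquareIntegrable Δp →
      ((predictiveRD A B C n).linearize (uniformState A B n) (uniformPayoff n)).IsTrajectory
        Δp ξ → ξ 0 = 0 →
      ((standardRD n).linearize (uniformScore n) (uniformPayoff n)).IsTrajectory Δp ζ →
      ζ 0 = 0 →
      UniformlyDominates (uniformPayoff n + Δp)
        ((predictiveRD A B C n).firstOrderOutput (uniformState A B n) (uniformPayoff n) ξ Δp)
        ((standardRD n).firstOrderOutput (uniformScore n) (uniformPayoff n) ζ Δp) ∧
      (IsStrictlyPassiveTransfer A B C →
        ∀ T : ℝ, 0 < T →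
          (¬ ∀ᵐ t ∂(volume.restrict (Set.Icc 0 T)), ∃ c : ℝ, Δp t = c • 1) →
          ∫ t in (0 : ℝ)..T, (uniformPayoff n + Δp) t ⬝ᵥ
              (standardRD n).firstOrderOutput (uniformScore n) (uniformPayoff n) ζ Δp t <
            ∫ t in (0 : ℝ)..T, (uniformPayoff n + Δp) t ⬝ᵥ
              (predictiveRD A B C n).firstOrderOutput (uniformState A B n)
                (uniformPayoff n) ξ Δp t)) := by
  refine ⟨⟨isTrajectory_uniform hstable, comparisonSystem_out_uniform⟩,
    isIOPassive_linearize hstable hpassive, fun h => isPassive_linearize ?_, ?_⟩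
  · exact h.elim (isPassive_predictor_of_isControllable hstable hpassive) id
  intro Δp ξ ζ hΔp hξ hξ0 hζ hζ0
  have hnonneg : ∀ i : Fin n, ∀ T : ℝ, 0 ≤ T → 0 ≤ ∫ t in (0 : ℝ)..T,
      centeredInput n i (Δp t) ⬝ᵥ C *ᵥ centeredState m n i (ξ t) := fun i T hT =>
    integral_supply_nonneg hstable hpassive (hΔp.map _) (isTrajectory_centeredState hξ i)
      (centeredState_zero i hξ0) hT
  refine ⟨fun T hT => ?_, fun hstrict T hT hne => ?_⟩
  · rw [integral_payoff_predictive_eq hΔp hξ hξ0 hζ hζ0 hT.le]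
    exact le_add_of_nonneg_right
      (mul_nonneg (by positivity) (Finset.sum_nonneg fun i _ => hnonneg i T hT.le))
  · rw [integral_payoff_predictive_eq hΔp hξ hξ0 hζ hζ0 hT.le]
    obtain ⟨i, hi⟩ : ∃ i : Fin n, ¬ ∀ᵐ t ∂(volume.restrict (Set.Icc 0 T)),
        centeredInput n i (Δp t) = 0 := by
      by_contra! h
      exact hne (ae_eq_const_of_centeredInput_ae_eq_zero h)
    have hn : (0 : ℝ) < n := by exact_mod_cast Fin.pos i
    refine lt_add_of_pos_right _ (mul_pos (by positivity) (Finset.sum_pos'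
      (fun i _ => hnonneg i T hT.le) ⟨i, Finset.mem_univ i, ?_⟩))
    exact integral_supply_pos hstable hstrict (hΔp.map _) (isTrajectory_centeredState hξ i)
      (centeredState_zero i hξ0) hT.le hi
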